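/- Let $S$ be a finite set and $\mu:S\times S\to\mathbb R_+$ a directed distance, i.e. $\mu(s,s)=0$ for all $s\in S$. A network $(G,S,c)$ is a finite directed graph $G=(VG,EG)$ with $S\subseteq VG$ (the elements of $S$ are called terminals) and edge capacities $c:EG\to\mathbb Z_+$. An $S$-path is a directed path joining distinct terminals. A multiflow is a set $\mathcal P$ of $S$-paths with $\lambda:\mathcal P\to\mathbb R_+$ such that $\sum\{\lambda(P): P\in\mathcal P,\ P\ni e\}\le c(e)$ for all $e\in EG$. ${\rm MFP}^*(\mu;G,S,c)$ denotes the maximum of $\sum_{P\in\mathcal P}\lambda(P)\mu(s_P,t_P)$ over all multiflows, where $P$ runs from $s_P$ to $t_P$. A node fulfills the Eulerian condition if the total capacity of the edges leaving it equals that of the edges entering it; the network is totally Eulerian if every node fulfills it. Let $S^c,S^r$ be two disjoint copies of $S$ and $S^{cr}=S^c\cup S^r$. For $X\subseteq S$ let $X^c,X^r$ be the corresponding copies, and for $p\in\mathbb R^{S^{cr}}$ let $p^c,p^r$ be its restrictions to $S^c,S^r$. Put $$P_\mu=\{p\in\mathbb R^{S^{cr}}: p(s^c)+p(t^r)\ge\mu(s,t)\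 \ (s,t\in S)\},$$ let $Q_\mu$ be the set of coordinatewise minimal elements of $P_\mu$, and put $$D_\infty(p,q)=\max\Big\{\max_{s\in S}\,(q(s^c)-p(s^c))_+,\ \max_{s\in S}\,(p(s^r)-q(s^r))_+\Big\}.$$ For $R\subseteq P_\mu$ let $R^+$ be the set of nonnegative points of $R$, and $R_s=\{p\in R: p(s^c)+p(s^r)=0\}$ for $s\in S$. ${\rm FLP}^*(R;G,S,c)$ denotes the minimum of $\sum_{xy\in EG}c(xy)D_\infty(\rho(x),\rho(y))$ over all maps $\rho:VG\to R$ with $\rho(s)\in R_s$ for all $s\in S$. For $p\in Q_\mu$ let $K(p)$ be the bipartite graph on $S^{cr}$ with edges $s^ct^r$ for $p(s^c)+p(t^r)=\mu(s,t)$, and for $U\subseteq S^{cr}$ let $N_p(U)$ be the set of nodes outside $U$ adjacent in $K(p)$ to a node of $U$. Let $\mathcal S_0$ be the family of $X\subseteq S$ with $\mu(s,t)=0$ for all $s,t\in X$. For $X\in\mathcal S_0$ let $Q_{\mu,X}$ be the set of $p\in Q_\mu$ such that, for every $s\in S$, $s^cs^r$ is an edge of $K(p)$ if and only if $s\in X$.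 A point $p\in Q_{\mu,X}$ is a fat relative to $X$ if $N_p(S^c\setminus X^c)\subseteq S^r\setminus X^r$ or $N_p(S^r\setminus X^r)\subseteq S^c\setminus X^c$. The degenerate set $Q_{\mu,X}^{deg}$ is the set of $p\in Q_{\mu,X}$ for which equality holds in at least one of these two inclusions. A fat is a point that is a fat relative to some $X\in\mathcal S_0$; a proper fat is a fat lying in no degenerate set. $Q_\mu^{slim}$ is $Q_\mu$ with all proper fats deleted. On $Q_\mu^{slim}$ let $p\sim q$ if $p-q\in(\mathbf 1,-\mathbf 1)\mathbb R$, or if for some $X\in\mathcal S_0$ both $p,q\in Q_{\mu,X}^{deg}$ and $p-q\in(\mathbf 1,-\mathbf 1)\mathbb R+(\mathbf 1_{X^c},-\mathbf 1_{X^r})\mathbb R$. A section is a subset of $Q_\mu^{slim}$ that projects bijectively onto $Q_\mu^{slim}/{\sim}$. A set $R\subseteq\mathbb R^{S^{cr}}$ is balanced if there are no two distinct points $p,q\in R$ with $p^c<q^c$ or with $p^r<q^r$, where $<$ is strict in every coordinate. A slimmed section in $(Q_\mu^{slim})^+$ is a balanced section $R\subseteq(Q_\mu^{slim})^+$ such that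 for each $X\in\mathcal S_0$ there are no two distinct points $p,q\in R\cap(Q_{\mu,X}^{deg})^+$ with $p(s^c)<q(s^c)$ for all $s\in S\setminus X$ or with $p(s^r)<q(s^r)$ for all $s\in S\setminus X$. A slimmed section in $Q_\mu^{slim}$ is a balanced section $R$ such that $R/(\mathbf 1,-\mathbf 1)\mathbb R=R'/(\mathbf 1,-\mathbf 1)\mathbb R$ for some slimmed section $R'$ in $(Q_\mu^{slim})^+$. A terminal $s$ is proper if $(Q_\mu)_s$ contains no fat, and a network is properly inner Eulerian (relative to $\mu$) if every node except the proper terminals fulfills the Eulerian condition. **Theorem.** Let $\mu$ be a directed distance on $S$. (1) ${\rm MFP}^*(\mu;G,S,c)={\rm FLP}^*(R;G,S,c)$ holds for every slimmed section $R$ in $(Q_\mu^{slim})^+$ and every properly inner Eulerian network $(G,S,c)$. (2) ${\rm MFP}^*(\mu;G,S,c)={\rm FLP}^*(R;G,S,c)$ holds for every slimmed section $R$ in $Q_\mu^{slim}$ and every totally Eulerian network $(G,S,c)$. In both cases the maximum and the minimum are attained. -/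

import Mathlib

open scoped NNReal

noncomputable section

namespace DirectedMultiflow

/-! ### Networks and multiflows -/

/-- A network `(G, S, c)`: a finite directed graph with node set `V`, terminals `S` (a subset of
the nodes, given by an injection) and nonnegative integer edge capacities. -/
structure Network (S V : Type*) where
  edges : Finset (V × V)
  terminal : S ↪ V
  cap : edges → ℕ

/-- A directed path (without repeated nodes) joining distinct terminals. -/
structure SPath {S V : Type*} (N : Network S V) where
  nodes : List V
  source : S
  target : S
  source_ne_target : source ≠ target
  head_eq : nodes.head? = some (N.terminal source)
  last_eq : nodes.getLast? = some (N.terminal target)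
  nodup : nodes.Nodup
  chain : nodes.IsChain (fun x y => (x, y) ∈ N.edges)

/-- The path contains the edge `e`: its tail and head are consecutive nodes of the path. -/
def SPath.Uses {S V : Type*} {N : Network S V} (P : SPath N) (e : V × V) : Prop :=
  [e.1, e.2] <:+: P.nodes

open Classical in
/-- A multiflow: a set of `S`-paths (there are only finitely many) with nonnegative flow values
obeying the capacities. Only the values of `flow` on `paths` matter. -/
structure Multiflow {S V : Type*} (N : Network S V) where
  paths : Finset (SPath N)
  flow : SPath N → ℝ≥0
  capacity : ∀ e : N.edges, ∑ P ∈ paths with P.Uses e.1, (flow P : ℝ) ≤ (N.cap e : ℝ)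

/-- The flow-value of a multiflow with respect to the terminal weight `μ`. -/
def Multiflow.val {S V : Type*} {N : Network S V} (f : Multiflow N) (μ : S → S → ℝ) : ℝ :=
  ∑ P ∈ f.paths, (f.flow P : ℝ) * μ P.source P.target

/-- `v` is the optimal (maximum) value of the `μ`-weighted maximum multiflow problem. -/
def IsMFPOpt {S V : Type*} (μ : S → S → ℝ) (N : Network S V) (v : ℝ) : Prop :=
  IsGreatest (Set.range fun f : Multiflow N => f.val μ) v

open Classical in
/-- The node `x` fulfills the Eulerian condition. -/
def Network.EulerianAt {S V : Type*} (N : Network S V) (x : V) : Prop :=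
  ∑ e : N.edges with e.1.1 = x, N.cap e = ∑ e : N.edges with e.1.2 = x, N.cap e

def Network.TotallyEulerian {S V : Type*} (N : Network S V) : Prop :=
  ∀ x, N.EulerianAt x

/-- A directed distance: nonnegative with zero diagonal. -/
def IsDirectedDistance {S : Type*} (μ : S → S → ℝ) : Prop :=
  (∀ s t, 0 ≤ μ s t) ∧ ∀ s, μ s s = 0

/-! ### The polyhedron, its directed metric and facility location

`S ⊕ S` is the disjoint union of the two copies `Sᶜ` (column copy, `Sum.inl`) and
`Sʳ` (row copy, `Sum.inr`) of `S`. -/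

/-- The space `ℝ^{S^{cr}}`. -/
abbrev Pt (S : Type*) := S ⊕ S → ℝ

/-- The column copy `X^c` of `X`. -/
def cCopy {S : Type*} (X : Set S) : Set (S ⊕ S) := Sum.inl '' X

/-- The row copy `X^r` of `X`. -/
def rCopy {S : Type*} (X : Set S) : Set (S ⊕ S) := Sum.inr '' X

/-- `D_∞⁺(p, q) = ‖(q - p)₊‖_∞` (for a finite index set). -/
def DinfPlus {X : Type*} (p q : X → ℝ) : ℝ := ⨆ x, max (q x - p x) 0

/-- `D_∞(p, q) = max (D_∞⁺(p^c, q^c), D_∞⁺(q^r, p^r))`. -/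
def Dinf {S : Type*} (p q : Pt S) : ℝ :=
  max (DinfPlus (fun s => p (Sum.inl s)) (fun s => q (Sum.inl s)))
    (DinfPlus (fun s => q (Sum.inr s)) (fun s => p (Sum.inr s)))

/-- The polyhedron `P_μ`. -/
def P {S : Type*} (μ : S → S → ℝ) : Set (Pt S) :=
  {p | ∀ s t, μ s t ≤ p (Sum.inl s) + p (Sum.inr t)}

/-- `R⁺`: the nonnegative points of `R`. -/
def posPart {S : Type*} (R : Set (Pt S)) : Set (Pt S) := {p ∈ R | ∀ u, 0 ≤ p u}

/-- `R_s`: the points of `R` with `p(s^c) + p(s^r) = 0`. -/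
def atTerminal {S : Type*} (R : Set (Pt S)) (s : S) : Set (Pt S) :=
  {p ∈ R | p (Sum.inl s) + p (Sum.inr s) = 0}

/-- `Q_μ`: the minimal elements of `P_μ` in the coordinatewise order. -/
def Q {S : Type*} (μ : S → S → ℝ) : Set (Pt S) := {p | Minimal (fun q => q ∈ P μ) p}

/-- The map `ρ` is feasible to the facility location problem on `R`. -/
def FLPFeasible {S V : Type*} (R : Set (Pt S)) (N : Network S V) (ρ : V → Pt S) : Prop :=
  (∀ x, ρ x ∈ R) ∧ ∀ s, ρ (N.terminal s) ∈ atTerminal R s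

/-- The objective value of the facility location problem. -/
def FLPCost {S V : Type*} (N : Network S V) (ρ : V → Pt S) : ℝ :=
  ∑ e : N.edges, (N.cap e : ℝ) * Dinf (ρ e.1.1) (ρ e.1.2)

/-- `v` is the optimal (minimum) value of the facility location problem on `R`. -/
def IsFLPOpt {S V : Type*} (R : Set (Pt S)) (N : Network S V) (v : ℝ) : Prop :=
  IsLeast {w | ∃ ρ : V → Pt S, FLPFeasible R N ρ ∧ w = FLPCost N ρ} v

/-! ### Fats, degenerate sets and the slimmed tropical polytope -/

/-- The bipartite graph `K(p)` on `S^{cr}` of tight constraints at `p`. -/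
def K {S : Type*} (μ : S → S → ℝ) (p : Pt S) : SimpleGraph (S ⊕ S) :=
  SimpleGraph.fromRel fun u v => ∃ s t, u = Sum.inl s ∧ v = Sum.inr t ∧ p u + p v = μ s t

/-- `N_p(U)`: the nodes outside `U` that are incident to `U` in `K(p)`. -/
def nbr {S : Type*} (μ : S → S → ℝ) (p : Pt S) (U : Set (S ⊕ S)) : Set (S ⊕ S) :=
  {v | v ∉ U ∧ ∃ u ∈ U, (K μ p).Adj u v}

/-- The family `𝒮₀` of sets of terminals on which `μ` vanishes. -/
def zeroSets {S : Type*} (μ : S → S → ℝ) : Set (Set S) :=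
  {X | ∀ s ∈ X, ∀ t ∈ X, μ s t = 0}

/-- `Q_{μ,X}`: the points `p` of `Q_μ` with `s^c s^r` an edge of `K(p)` exactly for `s ∈ X`. -/
def QX {S : Type*} (μ : S → S → ℝ) (X : Set S) : Set (Pt S) :=
  {p ∈ Q μ | ∀ s, (K μ p).Adj (Sum.inl s) (Sum.inr s) ↔ s ∈ X}

/-- `p` is a fat relative to `X`. -/
def IsFatRel {S : Type*} (μ : S → S → ℝ) (X : Set S) (p : Pt S) : Prop :=
  p ∈ QX μ X ∧ (nbr μ p (cCopy Xᶜ) ⊆ rCopy Xᶜ ∨ nbr μ p (rCopy Xᶜ) ⊆ cCopy Xᶜ)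

/-- The degenerate set `Q_{μ,X}^{deg}`. -/
def Qdeg {S : Type*} (μ : S → S → ℝ) (X : Set S) : Set (Pt S) :=
  {p ∈ QX μ X | nbr μ p (cCopy Xᶜ) = rCopy Xᶜ ∨ nbr μ p (rCopy Xᶜ) = cCopy Xᶜ}

def IsFat {S : Type*} (μ : S → S → ℝ) (p : Pt S) : Prop :=
  ∃ X ∈ zeroSets μ, IsFatRel μ X p

/-- A proper fat: a fat that lies in no degenerate set. -/
def IsProperFat {S : Type*} (μ : S → S → ℝ) (p : Pt S) : Prop :=
  IsFat μ p ∧ ∀ X ∈ zeroSets μ, p ∉ Qdeg μ X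

/-- `Q_μ^{slim}`: `Q_μ` with all proper fats deleted. -/
def Qslim {S : Type*} (μ : S → S → ℝ) : Set (Pt S) := {p ∈ Q μ | ¬ IsProperFat μ p}

/-- The vector `(𝟙_{X^c}, -𝟙_{X^r})`. -/
def vec {S : Type*} (X : Set S) : Pt S :=
  Sum.elim (X.indicator fun _ => 1) (X.indicator fun _ => -1)

/-- The line `(𝟙, -𝟙)ℝ`. -/
def line (S : Type*) : Submodule ℝ (Pt S) := Submodule.span ℝ {vec Set.univ}

/-- The relation `∼`. -/
def SlimRel {S : Type*} (μ : S → S → ℝ) (p q : Pt S) : Prop :=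
  p - q ∈ line S ∨
    ∃ X ∈ zeroSets μ, p ∈ Qdeg μ X ∧ q ∈ Qdeg μ X ∧
      p - q ∈ line S ⊔ Submodule.span ℝ {vec X}

lemma K_eq_of_sub_mem_line {S : Type*} (μ : S → S → ℝ) {p q : Pt S} (h : p - q ∈ line S) :
    K μ p = K μ q := by
  obtain ⟨a, ha⟩ := Submodule.mem_span_singleton.1 h
  have key : ∀ s t : S, p (Sum.inl s) + p (Sum.inr t) = q (Sum.inl s) + q (Sum.inr t) := by
    intro s t
    have h1 := congrFun ha (Sum.inl s)
    have h2 := congrFun ha (Sum.inr t)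
    simp [vec] at h1 h2
    linarith
  unfold K
  congr 1
  funext u v
  apply propext
  constructor
  · rintro ⟨s, t, rfl, rfl, h⟩
    exact ⟨s, t, rfl, rfl, by rw [← key]; exact h⟩
  · rintro ⟨s, t, rfl, rfl, h⟩
    exact ⟨s, t, rfl, rfl, by rw [key]; exact h⟩

lemma Qdeg_of_sub_mem_line {S : Type*} (μ : S → S → ℝ) {p q : Pt S} (hp : p ∈ Q μ)
    (h : p - q ∈ line S) {X : Set S} (hq : q ∈ Qdeg μ X) : p ∈ Qdeg μ X := by
  have hK := K_eq_of_sub_mem_line μ h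
  obtain ⟨⟨_, h1⟩, h2⟩ := hq
  refine ⟨⟨hp, ?_⟩, ?_⟩
  · rw [hK]
    exact h1
  · simp only [nbr, hK] at h2 ⊢
    exact h2

lemma sub_mem_symm {S : Type*} {W : Submodule ℝ (Pt S)} {p q : Pt S} (h : p - q ∈ W) :
    q - p ∈ W := by
  have := W.neg_mem h
  rwa [neg_sub] at this

lemma sub_mem_trans {S : Type*} {W : Submodule ℝ (Pt S)} {p q r : Pt S} (h : p - q ∈ W)
    (h' : q - r ∈ W) : p - r ∈ W := by
  have := W.add_mem h h'
  rwa [sub_add_sub_cancel] at this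

/-- The relation `∼` as an equivalence relation on `Q_μ^{slim}`. -/
def slimSetoid {S : Type*} (μ : S → S → ℝ) : Setoid (Qslim μ) where
  r p q := SlimRel μ p.1 q.1
  iseqv :=
    { refl := fun p => Or.inl (by simp)
      symm := by
        rintro p q (h | ⟨X, hX, hp, hq, h⟩)
        · exact Or.inl (sub_mem_symm h)
        · exact Or.inr ⟨X, hX, hq, hp, sub_mem_symm h⟩
      trans := by
        rintro ⟨p, hp⟩ ⟨q, hq⟩ ⟨r, hr⟩ (h | ⟨X, hX, hpX, hqX, h⟩) (h' | ⟨Y, hY, hqY, hrY, h'⟩)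
        · exact Or.inl (sub_mem_trans h h')
        · exact Or.inr ⟨Y, hY, Qdeg_of_sub_mem_line μ hp.1 h hqY, hrY,
            sub_mem_trans (Submodule.mem_sup_left h) h'⟩
        · exact Or.inr ⟨X, hX, hpX, Qdeg_of_sub_mem_line μ hr.1 (sub_mem_symm h') hqX,
            sub_mem_trans h (Submodule.mem_sup_left h')⟩
        · have hXY : X = Y := by
            ext s
            rw [← hqX.1.2 s, ← hqY.1.2 s]
          subst hXY
          exact Or.inr ⟨X, hX, hpX, hrY, sub_mem_trans h h'⟩ }

/-- The slimmed tropical polytope `Q_μ^{slim} / ∼`. -/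
def SlimmedTropicalPolytope {S : Type*} (μ : S → S → ℝ) : Type _ := Quotient (slimSetoid μ)

/-! ### Slimmed sections -/

/-- A section: a subset of `Q_μ^{slim}` that projects bijectively onto the slimmed tropical
polytope. -/
def IsSlimSection {S : Type*} (μ : S → S → ℝ) (R : Set (Pt S)) : Prop :=
  R ⊆ Qslim μ ∧
    Set.BijOn (fun p : Qslim μ => (Quotient.mk (slimSetoid μ) p : SlimmedTropicalPolytope μ))
      (Subtype.val ⁻¹' R) Set.univ

/-- Balanced: no two points `p, q` of `R` satisfy `p^c < q^c` or `p^r < q^r`, where `<` is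
strict in every coordinate. -/
def IsBalanced {S : Type*} (R : Set (Pt S)) : Prop :=
  ∀ p ∈ R, ∀ q ∈ R, p ≠ q →
    ¬ ((∀ s, p (Sum.inl s) < q (Sum.inl s)) ∨ ∀ s, p (Sum.inr s) < q (Sum.inr s))

/-- A slimmed section in `(Q_μ^{slim})⁺`. -/
def IsNonnegSlimmedSection {S : Type*} (μ : S → S → ℝ) (R : Set (Pt S)) : Prop :=
  R ⊆ posPart (Qslim μ) ∧ IsSlimSection μ R ∧ IsBalanced R ∧
    ∀ X ∈ zeroSets μ, ∀ p ∈ R ∩ posPart (Qdeg μ X), ∀ q ∈ R ∩ posPart (Qdeg μ X), p ≠ q →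
      ¬ ((∀ s ∉ X, p (Sum.inl s) < q (Sum.inl s)) ∨ ∀ s ∉ X, p (Sum.inr s) < q (Sum.inr s))

/-- A slimmed section in `Q_μ^{slim}`. -/
def IsSlimmedSection {S : Type*} (μ : S → S → ℝ) (R : Set (Pt S)) : Prop :=
  IsSlimSection μ R ∧ IsBalanced R ∧
    ∃ R', IsNonnegSlimmedSection μ R' ∧ (line S).mkQ '' R = (line S).mkQ '' R'

/-- A terminal `s` is proper if `(Q_μ)_s` has no fat. -/
def IsProperTerminal {S : Type*} (μ : S → S → ℝ) (s : S) : Prop :=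
  ∀ p ∈ atTerminal (Q μ) s, ¬ IsFat μ p

/-- Every node except proper terminals fulfills the Eulerian condition. -/
def Network.ProperlyInnerEulerian {S V : Type*} (N : Network S V) (μ : S → S → ℝ) : Prop :=
  ∀ x, (¬ ∃ s, N.terminal s = x ∧ IsProperTerminal μ s) → N.EulerianAt x

end DirectedMultiflow

end

/-!
By linear programming duality the maximum multiflow value is the least total length of the edges
over nonnegative edge lengths for which every `S`-path from `s` to `t` has length at least `μ s t`.
For optimal lengths, the distances of a node from and to the terminals form a nonnegative point of
`P μ`, which gives a location whose cost is at most this value. Conversely the distances `Dinf`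
between the ends of the edges of any location are feasible edge lengths, so it remains to move the
location into the section without increasing its cost.

The untruncated distance `signedDinf` makes this possible. It agrees with `Dinf` on balanced sets,
and translating the location of a node along `(𝟙, -𝟙)` changes the cost in proportion to the
excess of that node, hence not at all under the Eulerian condition. The retraction of `P μ` onto
`Q μ` does not increase signed distances. If a point of a location in `Q μ` is a proper fat, then
all the points that are fats on the same side can be pushed simultaneously by a small amount,
again without increasing signed distances, and the total of all coordinates decreases. By
compactness there is a location of minimal total, and it lies in `Qslim μ`. Replacing its points
by their representatives in the section does not increase the signed distances, up to translations.
Coordinates in a degenerate set `X` are moved differently from the others, but they determine the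
signed distance only between two points that are degenerate with respect to the same `X`. In the
section these vanish on `X`, and slimmedness provides a nonnegative difference outside `X`.
-/

noncomputable section

namespace DirectedMultiflow

/-! ### Signed distances -/

section Points

variable {S : Type*}

/-- The distance `Dinf` without the truncation at zero. -/
def signedDinf (p q : Pt S) : ℝ :=
  ⨆ s, max (q (Sum.inl s) - p (Sum.inl s)) (p (Sum.inr s) - q (Sum.inr s))

section Finite

variable [Finite S]

lemma sub_inl_le_signedDinf (p q : Pt S) (s : S) :
    q (Sum.inl s) - p (Sum.inl s) ≤ signedDinf p q :=
  (le_max_left _ _).trans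
    (Finite.le_ciSup
      (fun s => max (q (Sum.inl s) - p (Sum.inl s)) (p (Sum.inr s) - q (Sum.inr s))) s)

lemma sub_inr_le_signedDinf (p q : Pt S) (s : S) :
    p (Sum.inr s) - q (Sum.inr s) ≤ signedDinf p q :=
  (le_max_right _ _).trans
    (Finite.le_ciSup
      (fun s => max (q (Sum.inl s) - p (Sum.inl s)) (p (Sum.inr s) - q (Sum.inr s))) s)

lemma sub_inl_le_Dinf (p q : Pt S) (s : S) : q (Sum.inl s) - p (Sum.inl s) ≤ Dinf p q :=
  ((le_max_left _ 0).trans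
    (Finite.le_ciSup (fun s => max (q (Sum.inl s) - p (Sum.inl s)) 0) s)).trans (le_max_left _ _)

lemma sub_inr_le_Dinf (p q : Pt S) (s : S) : p (Sum.inr s) - q (Sum.inr s) ≤ Dinf p q :=
  ((le_max_left _ 0).trans
    (Finite.le_ciSup (fun s => max (p (Sum.inr s) - q (Sum.inr s)) 0) s)).trans (le_max_right _ _)

end Finite

lemma signedDinf_le [Nonempty S] {p q : Pt S} {d : ℝ}
    (hinl : ∀ s, q (Sum.inl s) - p (Sum.inl s) ≤ d)
    (hinr : ∀ s, p (Sum.inr s) - q (Sum.inr s) ≤ d) : signedDinf p q ≤ d :=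
  ciSup_le fun s => max_le (hinl s) (hinr s)

lemma Dinf_le [Nonempty S] {p q : Pt S} {d : ℝ} (hd : 0 ≤ d)
    (hinl : ∀ s, q (Sum.inl s) - p (Sum.inl s) ≤ d)
    (hinr : ∀ s, p (Sum.inr s) - q (Sum.inr s) ≤ d) : Dinf p q ≤ d :=
  max_le (ciSup_le fun s => max_le (hinl s) hd) (ciSup_le fun s => max_le (hinr s) hd)

lemma Dinf_nonneg (p q : Pt S) : 0 ≤ Dinf p q :=
  le_max_of_le_left (Real.iSup_nonneg fun _ => le_max_right _ _)

lemma signedDinf_le_Dinf [Finite S] [Nonempty S] (p q : Pt S) : signedDinf p q ≤ Dinf p q :=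
  signedDinf_le (sub_inl_le_Dinf p q) (sub_inr_le_Dinf p q)

lemma IsBalanced.Dinf_eq_signedDinf [Finite S] [Nonempty S] {R : Set (Pt S)} (hR : IsBalanced R)
    {p q : Pt S} (hp : p ∈ R) (hq : q ∈ R) : Dinf p q = signedDinf p q := by
  have exists_le : ∃ s, p (Sum.inl s) ≤ q (Sum.inl s) := by
    rcases eq_or_ne q p with rfl | hne
    · exact ⟨Classical.arbitrary S, le_rfl⟩
    · simpa using (not_or.1 (hR q hq p hp hne)).1
  obtain ⟨s, hs⟩ := exists_le
  have signedDinf_nonneg : 0 ≤ signedDinf p q :=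
    (sub_nonneg.2 hs).trans (sub_inl_le_signedDinf p q s)
  exact le_antisymm
    (Dinf_le signedDinf_nonneg (sub_inl_le_signedDinf p q) (sub_inr_le_signedDinf p q))
    (signedDinf_le_Dinf p q)

lemma continuous_signedDinf [Finite S] [Nonempty S] :
    Continuous fun a : Pt S × Pt S => signedDinf a.1 a.2 := by
  have := Fintype.ofFinite S
  simp only [signedDinf, ← Finset.sup'_univ_eq_ciSup]
  exact Continuous.finset_sup'_apply _ fun s _ => by fun_prop

/-- The total of the coordinates of a point, the potential that decreases when a location is
improved. -/
def size [Fintype S] (p : Pt S) : ℝ := ∑ s, (p (Sum.inl s) + p (Sum.inr s))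

lemma size_strictMono [Fintype S] : StrictMono (size : Pt S → ℝ) := by
  intro p q hpq
  obtain ⟨hle, u, hu⟩ := Pi.lt_def.1 hpq
  refine Finset.sum_lt_sum (fun s _ => add_le_add (hle _) (hle _)) ?_
  rcases u with s | s
  · exact ⟨s, Finset.mem_univ s, add_lt_add_of_lt_of_le hu (hle _)⟩
  · exact ⟨s, Finset.mem_univ s, add_lt_add_of_le_of_lt (hle _) hu⟩

lemma continuous_size [Fintype S] : Continuous (size : Pt S → ℝ) := by
  unfold size
  fun_prop

/-- The set of the terminals `s` at which `p` may be located: the terminals with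
`p ∈ atTerminal R s`, for any `R` containing `p`. -/
def zeroSet (p : Pt S) : Set S := {s | p (Sum.inl s) + p (Sum.inr s) = 0}

/-- The inequality of `P μ` for the pair `(s, t)` is an equality at `p`. -/
def Tight (μ : S → S → ℝ) (p : Pt S) (s t : S) : Prop := p (Sum.inl s) + p (Sum.inr t) = μ s t

/-! ### Reversal -/

/-- The exchange of the column and the row copy. Together with the exchange of the arguments of
`μ` it carries every statement about columns to the one about rows. -/
def swapPt (p : Pt S) : Pt S := p ∘ Sum.swap

@[simp] lemma swapPt_inl (p : Pt S) (s : S) : swapPt p (Sum.inl s) = p (Sum.inr s) := rfl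

@[simp] lemma swapPt_inr (p : Pt S) (s : S) : swapPt p (Sum.inr s) = p (Sum.inl s) := rfl

@[simp] lemma swapPt_swapPt (p : Pt S) : swapPt (swapPt p) = p := by
  simp [swapPt, Function.comp_assoc]

@[simp] lemma zeroSet_swapPt (p : Pt S) : zeroSet (swapPt p) = zeroSet p := by
  simp [zeroSet, add_comm]

@[simp] lemma size_swapPt [Fintype S] (p : Pt S) : size (swapPt p) = size p := by
  simp [size, add_comm]

@[simp] lemma signedDinf_swapPt (p q : Pt S) :
    signedDinf (swapPt p) (swapPt q) = signedDinf q p := by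
  simp [signedDinf, max_comm]

variable {μ : S → S → ℝ} {p : Pt S}

@[simp] lemma tight_swapPt {s t : S} :
    Tight (Function.swap μ) (swapPt p) s t ↔ Tight μ p t s := by
  simp [Tight, Function.swap, add_comm]

@[simp] lemma swapPt_mem_P : swapPt p ∈ P (Function.swap μ) ↔ p ∈ P μ := by
  simp only [P, Set.mem_ofPred_eq, swapPt_inl, swapPt_inr, Function.swap, add_comm]
  exact forall_comm

lemma swapPt_le_iff {q : Pt S} : swapPt p ≤ q ↔ p ≤ swapPt q := by
  simp [Pi.le_def, and_comm]

@[simp] lemma swapPt_mem_Q : swapPt p ∈ Q (Function.swap μ) ↔ p ∈ Q μ := by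
  have swapPt_mem {μ : S → S → ℝ} {p : Pt S} (hp : p ∈ Q μ) : swapPt p ∈ Q (Function.swap μ) :=
    ⟨swapPt_mem_P.2 hp.1, fun q hq hqp =>
      swapPt_le_iff.2 (hp.2 (swapPt_mem_P.2 hq) (swapPt_le_iff.2 hqp))⟩
  exact ⟨fun h => by simpa using swapPt_mem h, swapPt_mem⟩

/-! ### Translation -/

/-- The translation of `p` along the line `(𝟙, -𝟙)ℝ`. -/
def translate (p : Pt S) (h : ℝ) : Pt S :=
  Sum.elim (fun s => p (Sum.inl s) + h) (fun s => p (Sum.inr s) - h)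

@[simp] lemma translate_inl (p : Pt S) (h : ℝ) (s : S) :
    translate p h (Sum.inl s) = p (Sum.inl s) + h := rfl

@[simp] lemma translate_inr (p : Pt S) (h : ℝ) (s : S) :
    translate p h (Sum.inr s) = p (Sum.inr s) - h := rfl

@[simp] lemma zeroSet_translate (p : Pt S) (h : ℝ) : zeroSet (translate p h) = zeroSet p := by
  simp [zeroSet]

@[simp] lemma size_translate [Fintype S] (p : Pt S) (h : ℝ) : size (translate p h) = size p := by
  simp [size]

@[simp] lemma translate_zero (p : Pt S) : translate p 0 = p := by
  ext (s | s) <;> simp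

lemma translate_mem_P (hp : p ∈ P μ) (h : ℝ) : translate p h ∈ P μ := by
  intro s t
  simpa using hp s t

lemma sub_mem_line_iff {q : Pt S} : p - q ∈ line S ↔ ∃ h, p = translate q h := by
  rw [line, Submodule.mem_span_singleton]
  simp only [vec, Set.indicator_univ, funext_iff, Sum.forall, Pi.smul_apply, Pi.sub_apply,
    Sum.elim_inl, Sum.elim_inr, smul_eq_mul, mul_one, mul_neg, translate_inl, translate_inr]
  refine exists_congr fun h => and_congr ?_ ?_ <;> refine forall_congr' fun s => ?_ <;> grind

lemma signedDinf_translate [Finite S] [Nonempty S] (p q : Pt S) (h k : ℝ) :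
    signedDinf (translate p h) (translate q k) = signedDinf p q + (k - h) := by
  rw [signedDinf, signedDinf, ciSup_add (Set.finite_range _).bddAbove]
  simp only [translate_inl, translate_inr, max_add]
  congr! 3 <;> ring

/-- The translate whose smallest column coordinate is zero. -/
def normalize (p : Pt S) : Pt S := translate p (-⨅ s, p (Sum.inl s))

lemma normalize_nonneg [Finite S] (hμ : ∀ s t, 0 ≤ μ s t) (hp : p ∈ P μ)
    (u : S ⊕ S) : 0 ≤ normalize p u := by
  rcases u with s | s
  · simpa [normalize] using Finite.ciInf_le (fun s => p (Sum.inl s)) s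
  · have : Nonempty S := ⟨s⟩
    obtain ⟨t, ht⟩ := exists_eq_ciInf_of_finite (f := fun s => p (Sum.inl s))
    simpa [normalize, ← ht, add_comm] using (hμ t s).trans (hp t s)

lemma iInf_inl_eq_zero [Finite S] (hp : ∀ s, 0 ≤ p (Sum.inl s)) {s : S}
    (hs : p (Sum.inl s) = 0) : ⨅ s, p (Sum.inl s) = 0 :=
  le_antisymm ((Finite.ciInf_le (fun s => p (Sum.inl s)) s).trans_eq hs) (Real.iInf_nonneg hp)

/-! ### The retraction onto the minimal points -/

/-- The smallest column part that is feasible together with the row part `r`. For `Function.swap μ`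
this is the smallest row part that is feasible together with a given column part. -/
def minCol (μ : S → S → ℝ) (r : S → ℝ) (s : S) : ℝ := ⨆ t, (μ s t - r t)

lemma minCol_le [Nonempty S] {r : S → ℝ} {s : S} {a : ℝ} (h : ∀ t, μ s t - r t ≤ a) :
    minCol μ r s ≤ a :=
  ciSup_le h

/-- A point of `Q μ` below `p`, obtained by lowering first the column and then the row part. -/
def retract (μ : S → S → ℝ) (p : Pt S) : Pt S :=
  Sum.elim (minCol μ fun t => p (Sum.inr t))
    (minCol (Function.swap μ) (minCol μ fun t => p (Sum.inr t)))

@[simp] lemma retract_inl (μ : S → S → ℝ) (p : Pt S) (s : S) :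
    retract μ p (Sum.inl s) = minCol μ (fun t => p (Sum.inr t)) s := rfl

@[simp] lemma retract_inr (μ : S → S → ℝ) (p : Pt S) (t : S) :
    retract μ p (Sum.inr t) =
      minCol (Function.swap μ) (minCol μ fun t => p (Sum.inr t)) t := rfl

section Finite

variable [Finite S]

lemma sub_le_minCol (μ : S → S → ℝ) (r : S → ℝ) (s t : S) : μ s t - r t ≤ minCol μ r s :=
  Finite.le_ciSup (fun t => μ s t - r t) t

lemma exists_minCol_eq (μ : S → S → ℝ) (r : S → ℝ) (s : S) : ∃ t, minCol μ r s = μ s t - r t := by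
  have : Nonempty S := ⟨s⟩
  obtain ⟨t, ht⟩ := exists_eq_ciSup_of_finite (f := fun t => μ s t - r t)
  exact ⟨t, ht.symm⟩

lemma exists_tight_inl (hp : p ∈ Q μ) (s : S) : ∃ t, Tight μ p s t := by
  classical
  let m := minCol μ (fun t => p (Sum.inr t)) s
  obtain ⟨t, ht⟩ : ∃ t, m = μ s t - p (Sum.inr t) := exists_minCol_eq _ _ s
  have lowered_mem_P : Function.update p (Sum.inl s) m ∈ P μ := by
    intro s' t'
    rcases eq_or_ne s' s with rfl | hne
    · simpa [m] using sub_le_minCol μ (fun t => p (Sum.inr t)) s' t'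
    · simpa [hne] using hp.1 s' t'
  have m_le : m ≤ p (Sum.inl s) := by linarith [hp.1 s t]
  have le_m : p (Sum.inl s) ≤ m := by
    simpa using hp.2 lowered_mem_P (update_le_self_iff.2 m_le) (Sum.inl s)
  exact ⟨t, by rw [Tight]; linarith⟩

lemma exists_tight_inr (hp : p ∈ Q μ) (t : S) : ∃ s, Tight μ p s t := by
  simpa using exists_tight_inl (swapPt_mem_Q.2 hp) t

lemma mem_Q_iff :
    p ∈ Q μ ↔ p ∈ P μ ∧ (∀ s, ∃ t, Tight μ p s t) ∧ ∀ t, ∃ s, Tight μ p s t := by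
  refine ⟨fun hp => ⟨hp.1, exists_tight_inl hp, exists_tight_inr hp⟩, ?_⟩
  rintro ⟨hp, hinl, hinr⟩
  refine ⟨hp, fun q hq hqp => ?_⟩
  rintro (s | t)
  · obtain ⟨t, ht : _ = _⟩ := hinl s
    linarith [hq s t, hqp (Sum.inr t)]
  · obtain ⟨s, hs : _ = _⟩ := hinr t
    linarith [hq s t, hqp (Sum.inl s)]

variable {q : Pt S} {d : ℝ}

lemma signedDinf_le_of_inr [Nonempty S] (hp : p ∈ P μ) (hq : q ∈ Q μ)
    (hinr : ∀ s, p (Sum.inr s) - q (Sum.inr s) ≤ d) : signedDinf p q ≤ d := by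
  refine signedDinf_le (fun s => ?_) hinr
  obtain ⟨t, ht : _ = _⟩ := exists_tight_inl hq s
  linarith [hp s t, hinr t]

lemma signedDinf_le_of_inl [Nonempty S] (hp : p ∈ Q μ) (hq : q ∈ P μ)
    (hinl : ∀ s, q (Sum.inl s) - p (Sum.inl s) ≤ d) : signedDinf p q ≤ d := by
  rw [← signedDinf_swapPt]
  exact signedDinf_le_of_inr (swapPt_mem_P.2 hq) (swapPt_mem_Q.2 hp) hinl

lemma retract_inr_le (μ : S → S → ℝ) (p : Pt S) (t : S) :
    retract μ p (Sum.inr t) ≤ p (Sum.inr t) := by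
  have : Nonempty S := ⟨t⟩
  exact minCol_le fun s => sub_le_comm.1 (sub_le_minCol μ (fun t => p (Sum.inr t)) s t)

lemma retract_mem_Q (μ : S → S → ℝ) (p : Pt S) : retract μ p ∈ Q μ := by
  have retract_mem_P : retract μ p ∈ P μ := fun s t =>
    sub_le_iff_le_add'.1 (sub_le_minCol (Function.swap μ) (minCol μ fun t => p (Sum.inr t)) t s)
  refine mem_Q_iff.2 ⟨retract_mem_P, fun s => ?_, fun t => ?_⟩
  · obtain ⟨t, ht⟩ := exists_minCol_eq μ (fun t => p (Sum.inr t)) s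
    refine ⟨t, le_antisymm ?_ (retract_mem_P s t)⟩
    linarith [retract_inr_le μ p t, retract_inl μ p s]
  · obtain ⟨s, hs⟩ := exists_minCol_eq (Function.swap μ) (minCol μ fun t => p (Sum.inr t)) t
    exact ⟨s, by simp [Tight, hs, Function.swap]⟩

lemma retract_le (hp : p ∈ P μ) : retract μ p ≤ p := by
  rintro (s | t)
  · have : Nonempty S := ⟨s⟩
    exact minCol_le fun t => sub_le_iff_le_add.2 (hp s t)
  · exact retract_inr_le μ p t

lemma signedDinf_retract_le [Nonempty S] (μ : S → S → ℝ) (p q : Pt S) :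
    signedDinf (retract μ p) (retract μ q) ≤ signedDinf p q := by
  refine signedDinf_le_of_inl (retract_mem_Q μ p) (retract_mem_Q μ q).1 fun s => ?_
  obtain ⟨t, ht⟩ := exists_minCol_eq μ (fun t => q (Sum.inr t)) s
  have := sub_le_minCol μ (fun t => p (Sum.inr t)) s t
  simp only [retract_inl]
  linarith [sub_inr_le_signedDinf p q t]

end Finite

end Points

/-! ### Fats in terms of tight pairs -/

section Fats

variable {S : Type*} {μ : S → S → ℝ} {p q : Pt S} {s t : S} {X : Set S}

lemma IsDirectedDistance.swap (hμ : IsDirectedDistance μ) :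
    IsDirectedDistance (Function.swap μ) :=
  ⟨fun s t => hμ.1 t s, hμ.2⟩

lemma inl_add_inr_of_mem_zeroSet (hμ : ∀ s t, 0 ≤ μ s t) (hp : p ∈ P μ) (hs : s ∈ zeroSet p)
    (ht : t ∈ zeroSet p) : p (Sum.inl s) + p (Sum.inr t) = 0 := by
  have hs : _ = _ := hs
  have ht : _ = _ := ht
  linarith [hp s t, hp t s, hμ s t, hμ t s]

lemma zeroSet_mem_zeroSets (hμ : ∀ s t, 0 ≤ μ s t) (hp : p ∈ P μ) : zeroSet p ∈ zeroSets μ :=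
  fun s hs t ht =>
    ((hp s t).trans_eq (inl_add_inr_of_mem_zeroSet hμ hp hs ht)).antisymm (hμ s t)

/-- In `K(p)`, column nodes in `zeroSet p` are joined only to row nodes in `zeroSet p`. -/
def ColClosed (μ : S → S → ℝ) (p : Pt S) : Prop :=
  ∀ s ∈ zeroSet p, ∀ t, Tight μ p s t → t ∈ zeroSet p

/-- In `K(p)`, every column node outside `zeroSet p` is joined to a row node outside
`zeroSet p`. -/
def ColCovered (μ : S → S → ℝ) (p : Pt S) : Prop :=
  ∀ s ∉ zeroSet p, ∃ t ∉ zeroSet p, Tight μ p s t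

lemma K_adj_inl_inr : (K μ p).Adj (Sum.inl s) (Sum.inr t) ↔ Tight μ p s t := by
  simp [K, Tight]

lemma nbr_cCopy (μ : S → S → ℝ) (p : Pt S) (Y : Set S) :
    nbr μ p (cCopy Y) = rCopy {t | ∃ s ∈ Y, Tight μ p s t} := by
  ext u
  rcases u with s | t <;> simp [nbr, cCopy, rCopy, K, Tight]

lemma nbr_rCopy (μ : S → S → ℝ) (p : Pt S) (Y : Set S) :
    nbr μ p (rCopy Y) = cCopy {s | ∃ t ∈ Y, Tight μ p s t} := by
  ext u
  rcases u with s | t <;> simp [nbr, cCopy, rCopy, K, Tight, add_comm]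

lemma nbr_rCopy_compl_subset_iff :
    nbr μ p (rCopy (zeroSet p)ᶜ) ⊆ cCopy (zeroSet p)ᶜ ↔ ColClosed μ p := by
  rw [nbr_rCopy, cCopy, cCopy, Set.image_subset_image_iff Sum.inl_injective]
  exact ⟨fun h s hs t ht => by_contra fun hn => h ⟨t, hn, ht⟩ hs,
    fun h s ⟨t, hn, ht⟩ hs => hn (h s hs t ht)⟩

lemma nbr_cCopy_compl_subset_iff :
    nbr μ p (cCopy (zeroSet p)ᶜ) ⊆ rCopy (zeroSet p)ᶜ ↔
      ColClosed (Function.swap μ) (swapPt p) := by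
  rw [nbr_cCopy, rCopy, rCopy, Set.image_subset_image_iff Sum.inr_injective]
  simp only [ColClosed, zeroSet_swapPt, tight_swapPt]
  exact ⟨fun h t ht s hs => by_contra fun hn => h ⟨s, hn, hs⟩ ht,
    fun h t ⟨s, hn, hs⟩ ht => hn (h t ht s hs)⟩

lemma cCopy_compl_subset_nbr_iff :
    cCopy (zeroSet p)ᶜ ⊆ nbr μ p (rCopy (zeroSet p)ᶜ) ↔ ColCovered μ p := by
  rw [nbr_rCopy, cCopy, cCopy, Set.image_subset_image_iff Sum.inl_injective]
  rfl

lemma rCopy_compl_subset_nbr_iff :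
    rCopy (zeroSet p)ᶜ ⊆ nbr μ p (cCopy (zeroSet p)ᶜ) ↔
      ColCovered (Function.swap μ) (swapPt p) := by
  rw [nbr_cCopy, rCopy, rCopy, Set.image_subset_image_iff Sum.inr_injective]
  simp only [ColCovered, zeroSet_swapPt, tight_swapPt]
  rfl

lemma mem_QX_iff (hμ : ∀ s, μ s s = 0) : p ∈ QX μ X ↔ p ∈ Q μ ∧ X = zeroSet p := by
  refine and_congr_right fun _ => ?_
  simp only [K_adj_inl_inr, Tight, hμ, Set.ext_iff, zeroSet, Set.mem_ofPred_eq, iff_comm]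

lemma isFat_iff (hμ : IsDirectedDistance μ) :
    IsFat μ p ↔ p ∈ Q μ ∧ (ColClosed μ p ∨ ColClosed (Function.swap μ) (swapPt p)) := by
  have isFatRel_iff (X : Set S) : IsFatRel μ X p ↔
      p ∈ Q μ ∧ X = zeroSet p ∧ (ColClosed μ p ∨ ColClosed (Function.swap μ) (swapPt p)) := by
    rw [IsFatRel, mem_QX_iff hμ.2, and_assoc]
    refine and_congr_right fun _ => and_congr_right ?_
    rintro rfl
    rw [nbr_cCopy_compl_subset_iff, nbr_rCopy_compl_subset_iff, or_comm]
  simp only [IsFat, isFatRel_iff]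
  exact ⟨fun ⟨_, _, hp, _, h⟩ => ⟨hp, h⟩,
    fun ⟨hp, h⟩ => ⟨_, zeroSet_mem_zeroSets hμ.1 hp.1, hp, rfl, h⟩⟩

lemma mem_Qdeg_iff (hμ : ∀ s, μ s s = 0) :
    p ∈ Qdeg μ X ↔ p ∈ Q μ ∧ X = zeroSet p ∧ ((ColClosed μ p ∧ ColCovered μ p) ∨
      (ColClosed (Function.swap μ) (swapPt p) ∧ ColCovered (Function.swap μ) (swapPt p))) := by
  rw [Qdeg, Set.mem_ofPred_eq, mem_QX_iff hμ, and_assoc]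
  refine and_congr_right fun _ => and_congr_right ?_
  rintro rfl
  rw [Set.Subset.antisymm_iff, Set.Subset.antisymm_iff, nbr_cCopy_compl_subset_iff,
    nbr_rCopy_compl_subset_iff, cCopy_compl_subset_nbr_iff, rCopy_compl_subset_nbr_iff, or_comm]

lemma eq_zeroSet_of_mem_Qdeg (hμ : ∀ s, μ s s = 0) (hp : p ∈ Qdeg μ X) : X = zeroSet p :=
  ((mem_Qdeg_iff hμ).1 hp).2.1

lemma isProperFat_iff (hμ : IsDirectedDistance μ) :
    IsProperFat μ p ↔ IsFat μ p ∧ p ∉ Qdeg μ (zeroSet p) := by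
  refine and_congr_right fun hfat => ⟨fun h => h _ ?_, fun h X _ hX => h ?_⟩
  · exact zeroSet_mem_zeroSets hμ.1 ((isFat_iff hμ).1 hfat).1.1
  · rwa [← eq_zeroSet_of_mem_Qdeg hμ.2 hX]

lemma mem_Qdeg_of_isFat (hμ : IsDirectedDistance μ) (hp : p ∈ Qslim μ) (hfat : IsFat μ p) :
    p ∈ Qdeg μ (zeroSet p) :=
  not_not.1 fun h => hp.2 ((isProperFat_iff hμ).2 ⟨hfat, h⟩)

/-! ### Reversal of fats -/

lemma swapPt_mem_Qdeg (hμ : ∀ s, μ s s = 0) :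
    swapPt p ∈ Qdeg (Function.swap μ) X ↔ p ∈ Qdeg μ X := by
  rw [mem_Qdeg_iff hμ, mem_Qdeg_iff (μ := Function.swap μ) hμ, swapPt_mem_Q, zeroSet_swapPt,
    swapPt_swapPt, or_comm]

lemma isFat_swapPt (hμ : IsDirectedDistance μ) :
    IsFat (Function.swap μ) (swapPt p) ↔ IsFat μ p := by
  rw [isFat_iff hμ, isFat_iff hμ.swap, swapPt_mem_Q, swapPt_swapPt, or_comm]

lemma swapPt_mem_Qslim (hμ : IsDirectedDistance μ) :
    swapPt p ∈ Qslim (Function.swap μ) ↔ p ∈ Qslim μ := by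
  simp only [Qslim, Set.mem_ofPred_eq, isProperFat_iff hμ, isProperFat_iff hμ.swap, swapPt_mem_Q,
    isFat_swapPt hμ, zeroSet_swapPt, swapPt_mem_Qdeg hμ.2]

/-! ### Distances to points of another degenerate set -/

/-- On `X`, the row part of `q` attains its minimum at `x`, and outside `X` it exceeds this minimum
so much that no row node outside `X` is joined in `K(q)` to a column node in `X`. -/
structure IsRowValley (μ : S → S → ℝ) (q : Pt S) (X : Set S) (x : S) : Prop where
  mem : x ∈ X
  inr_le : ∀ y ∈ X, q (Sum.inr x) ≤ q (Sum.inr y)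
  lt_inr : ∀ y ∈ X, ∀ t ∉ X, μ y t + q (Sum.inr x) < q (Sum.inr t)

lemma exists_isRowValley [Finite S] (hμ : ∀ s t, 0 ≤ μ s t) (hp : p ∈ P μ) {d : ℝ}
    (hout : ∀ t ∉ zeroSet p, p (Sum.inr t) - q (Sum.inr t) ≤ d) (hs : s ∈ zeroSet p)
    (hd : d < p (Sum.inr s) - q (Sum.inr s)) : ∃ x, IsRowValley μ q (zeroSet p) x := by
  obtain ⟨x, hx, inr_le⟩ :=
    Set.exists_min_image (zeroSet p) (fun x => q (Sum.inr x)) (Set.toFinite _) ⟨s, hs⟩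
  refine ⟨x, hx, inr_le, fun y hy t ht => ?_⟩
  linarith [hp y t, hout t ht, inr_le s hs, inl_add_inr_of_mem_zeroSet hμ hp hy hs]

namespace IsRowValley

variable {x y : S} (h : IsRowValley μ q X x) (hX : X ∈ zeroSets μ) (hq : q ∈ Q μ)
include h hX hq

lemma of_tight (hy : y ∈ X) (ht : Tight μ q y t) :
    t ∈ X ∧ q (Sum.inr t) = q (Sum.inr x) ∧ q (Sum.inl y) = -q (Sum.inr x) := by
  have ht : _ = _ := ht
  have hyx := hq.1 y x
  have μ_yx : μ y x = 0 := hX y hy x h.mem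
  have t_mem : t ∈ X := by
    by_contra htX
    linarith [h.lt_inr y hy t htX]
  have μ_yt : μ y t = 0 := hX y hy t t_mem
  have hle := h.inr_le t t_mem
  exact ⟨t_mem, by linarith, by linarith⟩

variable [Finite S]

lemma inl_eq (hy : y ∈ X) : q (Sum.inl y) = -q (Sum.inr x) := by
  obtain ⟨t, ht⟩ := exists_tight_inl hq y
  exact (h.of_tight hX hq hy ht).2.2

lemma mem_zeroSet : x ∈ zeroSet q := by
  simp [zeroSet, h.inl_eq hX hq h.mem]

lemma mem_zeroSet_of_tight (hy : y ∈ X) (ht : Tight μ q y t) : t ∈ zeroSet q := by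
  obtain ⟨t_mem, inr_eq, -⟩ := h.of_tight hX hq hy ht
  simp [zeroSet, h.inl_eq hX hq t_mem, inr_eq]

lemma zeroSet_subset (hμ : ∀ s t, 0 ≤ μ s t) : zeroSet q ⊆ X := by
  intro t ht
  have hx := h.mem_zeroSet hX hq
  have tight : Tight μ q x t := by
    rw [Tight, inl_add_inr_of_mem_zeroSet hμ hq.1 hx ht, zeroSet_mem_zeroSets hμ hq.1 x hx t ht]
  exact (h.of_tight hX hq h.mem tight).1

lemma colClosed (hμ : ∀ s t, 0 ≤ μ s t) : ColClosed μ q :=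
  fun _ hs _ ht => h.mem_zeroSet_of_tight hX hq (h.zeroSet_subset hX hq hμ hs) ht

end IsRowValley

lemma IsRowValley.mem_Qdeg [Finite S] {x : S} (hμ : IsDirectedDistance μ)
    (h : IsRowValley μ q X x) (hX : X ∈ zeroSets μ) (hq : q ∈ Qslim μ) : q ∈ Qdeg μ X := by
  have colClosed := h.colClosed hX hq.1 hμ.1
  have hdeg := mem_Qdeg_of_isFat hμ hq ((isFat_iff hμ).2 ⟨hq.1, Or.inl colClosed⟩)
  suffices subset : X ⊆ zeroSet q by
    rwa [subset.antisymm (h.zeroSet_subset hX hq.1 hμ.1)]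
  intro y hy
  by_contra hyq
  obtain ⟨-, -, ⟨-, covered⟩ | ⟨rowClosed, -⟩⟩ := (mem_Qdeg_iff hμ.2).1 hdeg
  · obtain ⟨t, ht, tight⟩ := covered y hyq
    exact ht (h.mem_zeroSet_of_tight hX hq.1 hy tight)
  · obtain ⟨t, tight⟩ := exists_tight_inl hq.1 y
    have ht : t ∈ zeroSet q := h.mem_zeroSet_of_tight hX hq.1 hy tight
    exact hyq (by simpa using rowClosed t (by simpa using ht) y (tight_swapPt.2 tight))

lemma sub_inr_le_of_notMem_Qdeg [Finite S] (hμ : IsDirectedDistance μ) (hp : p ∈ P μ)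
    (hq : q ∈ Qslim μ) (hdeg : q ∉ Qdeg μ (zeroSet p)) {d : ℝ}
    (hout : ∀ t ∉ zeroSet p, p (Sum.inr t) - q (Sum.inr t) ≤ d) (s : S) :
    p (Sum.inr s) - q (Sum.inr s) ≤ d := by
  by_contra! hd
  have hs : s ∈ zeroSet p := not_not.1 fun hs => hd.not_ge (hout s hs)
  obtain ⟨x, valley⟩ := exists_isRowValley hμ.1 hp hout hs hd
  exact hdeg (valley.mem_Qdeg hμ (zeroSet_mem_zeroSets hμ.1 hp) hq)

lemma sub_inl_le_of_notMem_Qdeg [Finite S] (hμ : IsDirectedDistance μ) (hp : p ∈ P μ)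
    (hq : q ∈ Qslim μ) (hdeg : q ∉ Qdeg μ (zeroSet p)) {d : ℝ}
    (hout : ∀ t ∉ zeroSet p, p (Sum.inl t) - q (Sum.inl t) ≤ d) (s : S) :
    p (Sum.inl s) - q (Sum.inl s) ≤ d :=
  sub_inr_le_of_notMem_Qdeg hμ.swap (swapPt_mem_P.2 hp) ((swapPt_mem_Qslim hμ).2 hq)
    (by simpa [swapPt_mem_Qdeg hμ.2] using hdeg) (by simpa using hout) s

end Fats

/-! ### Pushing fats -/

section Push

open Filter Topology

variable {S : Type*} {μ : S → S → ℝ} {ε : ℝ} {p q : Pt S} {s t : S}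

/-- The row nodes that are raised by `push`: the zero set of `p` if `p` is column closed, and none
otherwise. -/
def movable (μ : S → S → ℝ) (p : Pt S) : Set S := {s ∈ zeroSet p | ColClosed μ p}

/-- Raises the row coordinates in `movable μ p` by `ε` and takes the smallest feasible column
part. -/
def push (μ : S → S → ℝ) (ε : ℝ) (p : Pt S) : Pt S :=
  Sum.elim (minCol μ fun t => p (Sum.inr t) + (movable μ p).indicator (fun _ => ε) t)
    fun t => p (Sum.inr t) + (movable μ p).indicator (fun _ => ε) t

/-- The condition on `ε` under which `push μ ε p` keeps the zero set of `p`. -/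
structure Slack (μ : S → S → ℝ) (ε : ℝ) (p : Pt S) : Prop where
  add_le : ∀ s ∈ movable μ p, ∀ t ∉ movable μ p, μ s t + ε ≤ p (Sum.inl s) + p (Sum.inr t)
  lt : ∀ s ∉ zeroSet p, ε < p (Sum.inl s) + p (Sum.inr s)

lemma eventually_slack [Finite S] (hμ : ∀ s, μ s s = 0) (hp : p ∈ P μ) :
    ∀ᶠ ε in 𝓝[>] 0, Slack μ ε p := by
  have eventually_lt {a : ℝ} (ha : 0 < a) : ∀ᶠ ε in 𝓝[>] 0, ε < a :=
    nhdsWithin_le_nhds (gt_mem_nhds ha)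
  have add_le : ∀ᶠ ε in 𝓝[>] 0, ∀ s ∈ movable μ p, ∀ t ∉ movable μ p,
      μ s t + ε ≤ p (Sum.inl s) + p (Sum.inr t) := by
    simp only [eventually_all]
    rintro s ⟨hs, colClosed⟩ t ht
    have not_tight : p (Sum.inl s) + p (Sum.inr t) ≠ μ s t :=
      fun tight => ht ⟨colClosed s hs t tight, colClosed⟩
    filter_upwards [eventually_lt (sub_pos.2 ((hp s t).lt_of_ne' not_tight))] with ε hε
    linarith
  have lt : ∀ᶠ ε in 𝓝[>] 0, ∀ s ∉ zeroSet p, ε < p (Sum.inl s) + p (Sum.inr s) := by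
    simp only [eventually_all]
    exact fun s hs => eventually_lt (((hμ s).symm.trans_le (hp s s)).lt_of_ne' hs)
  filter_upwards [add_le, lt] with ε add_le lt using ⟨add_le, lt⟩

lemma push_inr_of_mem (ht : t ∈ movable μ p) : push μ ε p (Sum.inr t) = p (Sum.inr t) + ε := by
  simp [push, ht]

lemma push_inr_of_notMem (ht : t ∉ movable μ p) : push μ ε p (Sum.inr t) = p (Sum.inr t) := by
  simp [push, ht]

lemma le_push_inr (hε : 0 ≤ ε) (t : S) : p (Sum.inr t) ≤ push μ ε p (Sum.inr t) := by
  by_cases ht : t ∈ movable μ p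
  · simpa [push_inr_of_mem ht] using hε
  · rw [push_inr_of_notMem ht]

lemma push_inr_le (hε : 0 ≤ ε) (t : S) : push μ ε p (Sum.inr t) ≤ p (Sum.inr t) + ε := by
  by_cases ht : t ∈ movable μ p
  · rw [push_inr_of_mem ht]
  · simpa [push_inr_of_notMem ht] using hε

variable [Finite S]

lemma push_mem_P (μ : S → S → ℝ) (ε : ℝ) (p : Pt S) : push μ ε p ∈ P μ := fun s t =>
  sub_le_iff_le_add.1 (sub_le_minCol μ
    (fun t => p (Sum.inr t) + (movable μ p).indicator (fun _ => ε) t) s t)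

lemma exists_tight_push (μ : S → S → ℝ) (ε : ℝ) (p : Pt S) (s : S) :
    ∃ t, Tight μ (push μ ε p) s t := by
  obtain ⟨t, ht⟩ :=
    exists_minCol_eq μ (fun t => p (Sum.inr t) + (movable μ p).indicator (fun _ => ε) t) s
  exact ⟨t, by simp [Tight, push, ht]⟩

lemma push_inl_le (hp : p ∈ P μ) (hε : 0 ≤ ε) (s : S) :
    push μ ε p (Sum.inl s) ≤ p (Sum.inl s) := by
  obtain ⟨t, tight : _ = _⟩ := exists_tight_push μ ε p s
  linarith [hp s t, le_push_inr (μ := μ) (p := p) hε t]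

lemma le_push_inl (hp : p ∈ Q μ) (hε : 0 ≤ ε) (s : S) :
    p (Sum.inl s) - ε ≤ push μ ε p (Sum.inl s) := by
  obtain ⟨t, tight : _ = _⟩ := exists_tight_inl hp s
  linarith [push_mem_P μ ε p s t, push_inr_le (μ := μ) (p := p) hε t]

lemma push_inl_of_mem (hμ : IsDirectedDistance μ) (hp : p ∈ P μ) (hslack : Slack μ ε p)
    (hs : s ∈ movable μ p) : push μ ε p (Sum.inl s) = p (Sum.inl s) - ε := by
  apply le_antisymm
  · obtain ⟨t, tight : _ = _⟩ := exists_tight_push μ ε p s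
    by_cases ht : t ∈ movable μ p
    · have := zeroSet_mem_zeroSets hμ.1 hp s hs.1 t ht.1
      linarith [push_inr_of_mem (ε := ε) ht, inl_add_inr_of_mem_zeroSet hμ.1 hp hs.1 ht.1]
    · linarith [push_inr_of_notMem (ε := ε) ht, hslack.add_le s hs t ht]
  · have : _ = _ := hs.1
    linarith [push_mem_P μ ε p s s, push_inr_of_mem (ε := ε) hs, hμ.2 s]

lemma push_inl_add_inr_le (hμ : IsDirectedDistance μ) (hp : p ∈ P μ) (hε : 0 ≤ ε)
    (hslack : Slack μ ε p) (s : S) :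
    push μ ε p (Sum.inl s) + push μ ε p (Sum.inr s) ≤ p (Sum.inl s) + p (Sum.inr s) := by
  by_cases hs : s ∈ movable μ p
  · simp [push_inl_of_mem hμ hp hslack hs, push_inr_of_mem hs]
  · simpa [push_inr_of_notMem hs] using push_inl_le hp hε s

lemma push_mem_Q (hμ : IsDirectedDistance μ) (hp : p ∈ Q μ) (hε : 0 ≤ ε)
    (hslack : Slack μ ε p) : push μ ε p ∈ Q μ := by
  refine mem_Q_iff.2 ⟨push_mem_P μ ε p, exists_tight_push μ ε p, fun t => ?_⟩
  by_cases ht : t ∈ movable μ p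
  · refine ⟨t, le_antisymm ?_ (push_mem_P μ ε p t t)⟩
    simpa [hμ.2, show _ = _ from ht.1] using push_inl_add_inr_le hμ hp.1 hε hslack t
  · obtain ⟨s, tight : _ = _⟩ := exists_tight_inr hp t
    refine ⟨s, le_antisymm ?_ (push_mem_P μ ε p s t)⟩
    linarith [push_inr_of_notMem (ε := ε) ht, push_inl_le hp.1 hε s]

lemma zeroSet_push (hμ : IsDirectedDistance μ) (hp : p ∈ Q μ) (hε : 0 ≤ ε)
    (hslack : Slack μ ε p) : zeroSet (push μ ε p) = zeroSet p := by
  ext s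
  by_cases hs : s ∈ zeroSet p
  · refine iff_of_true (le_antisymm ?_ ?_) hs
    · exact (push_inl_add_inr_le hμ hp.1 hε hslack s).trans_eq hs
    · exact (hμ.2 s).symm.trans_le (push_mem_P μ ε p s s)
  · refine iff_of_false (fun h : _ = _ => ?_) hs
    have notMem : s ∉ movable μ p := fun h => hs h.1
    linarith [hslack.lt s hs, le_push_inl hp hε s, push_inr_of_notMem (ε := ε) notMem]

lemma push_of_not_colClosed (hp : p ∈ Q μ) (h : ¬ ColClosed μ p) : push μ ε p = p := by
  have notMem (t : S) : t ∉ movable μ p := fun ht => h ht.2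
  have push_le : push μ ε p ≤ p := by
    rintro (s | t)
    · obtain ⟨t, tight : _ = _⟩ := exists_tight_push μ ε p s
      linarith [hp.1 s t, push_inr_of_notMem (ε := ε) (notMem t)]
    · exact (push_inr_of_notMem (notMem t)).le
  exact push_le.antisymm (hp.2 (push_mem_P μ ε p) push_le)

lemma signedDinf_push_le [Nonempty S] (hμ : IsDirectedDistance μ) (hp : p ∈ Q μ) (hq : q ∈ Q μ)
    (hε : 0 ≤ ε) (hslack : Slack μ ε p) (hslack' : Slack μ ε q) :
    signedDinf (push μ ε p) (push μ ε q) ≤ signedDinf p q := by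
  have push_p_mem := push_mem_P μ ε p
  have push_q_mem := push_mem_Q hμ hq hε hslack'
  have hout (t : S) (ht : t ∉ movable μ p) :
      push μ ε p (Sum.inr t) - push μ ε q (Sum.inr t) ≤ signedDinf p q := by
    rw [push_inr_of_notMem ht]
    linarith [le_push_inr (μ := μ) (p := q) hε t, sub_inr_le_signedDinf p q t]
  refine signedDinf_le_of_inr push_p_mem push_q_mem fun t => ?_
  by_contra! hd
  obtain ⟨ht, colClosed⟩ : t ∈ movable μ p := not_not.1 fun ht => hd.not_ge (hout t ht)
  rw [← zeroSet_push hμ hp hε hslack] at ht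
  obtain ⟨x, valley⟩ : ∃ x, IsRowValley μ (push μ ε q) (zeroSet (push μ ε p)) x := by
    refine exists_isRowValley hμ.1 push_p_mem (fun t ht => hout t fun h => ht ?_) ht hd
    rw [zeroSet_push hμ hp hε hslack]
    exact h.1
  have hX := zeroSet_mem_zeroSets hμ.1 push_p_mem
  have x_mem_p : x ∈ movable μ p := ⟨zeroSet_push hμ hp hε hslack ▸ valley.mem, colClosed⟩
  have x_mem_q : x ∈ movable μ q := by
    refine ⟨zeroSet_push hμ hq hε hslack' ▸ valley.mem_zeroSet hX push_q_mem, ?_⟩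
    by_contra h
    have colClosed_push := valley.colClosed hX push_q_mem hμ.1
    rw [push_of_not_colClosed hq h] at colClosed_push
    exact h colClosed_push
  have inr_eq : push μ ε p (Sum.inr t) = push μ ε p (Sum.inr x) := by
    have : _ = _ := ht
    linarith [inl_add_inr_of_mem_zeroSet hμ.1 push_p_mem ht valley.mem]
  linarith [valley.inr_le t ht, push_inr_of_mem (ε := ε) x_mem_p,
    push_inr_of_mem (ε := ε) x_mem_q, sub_inr_le_signedDinf p q x]

end Push

/-! ### Reductions of families of points -/

section Reduction

open Filter Topology

variable {S ι : Type*} {μ : S → S → ℝ} {ρ ρ' : ι → Pt S}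

lemma isProperTerminal_swap (hμ : IsDirectedDistance μ) {s : S} (h : IsProperTerminal μ s) :
    IsProperTerminal (Function.swap μ) s := by
  rintro p ⟨hp, hs⟩ hfat
  exact h (swapPt p) ⟨swapPt_mem_Q.2 hp, by simpa [add_comm] using hs⟩
    ((isFat_swapPt hμ.swap).2 hfat)

variable [Fintype S]

lemma size_push_le (hμ : IsDirectedDistance μ) {ε : ℝ} {p : Pt S} (hp : p ∈ P μ) (hε : 0 ≤ ε)
    (hslack : Slack μ ε p) : size (push μ ε p) ≤ size p :=
  Finset.sum_le_sum fun s _ => push_inl_add_inr_le hμ hp hε hslack s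

lemma size_push_lt (hμ : IsDirectedDistance μ) {ε : ℝ} {p : Pt S} (hp : p ∈ P μ) (hε : 0 < ε)
    (hslack : Slack μ ε p) (closed : ColClosed μ p) (not_covered : ¬ ColCovered μ p) :
    size (push μ ε p) < size p := by
  obtain ⟨s, hs, not_tight⟩ : ∃ s ∉ zeroSet p, ∀ t ∉ zeroSet p, ¬ Tight μ p s t := by
    simpa [ColCovered] using not_covered
  refine Finset.sum_lt_sum (fun s _ => push_inl_add_inr_le hμ hp hε.le hslack s)
    ⟨s, Finset.mem_univ s, ?_⟩
  rw [push_inr_of_notMem fun h => hs h.1, add_lt_add_iff_right]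
  obtain ⟨t, tight : _ = _⟩ := exists_tight_push μ ε p s
  by_cases ht : t ∈ zeroSet p
  · linarith [hp s t, push_inr_of_mem (ε := ε) (show t ∈ movable μ p from ⟨ht, closed⟩)]
  · have := (hp s t).lt_of_ne' (not_tight t ht)
    linarith [push_inr_of_notMem (ε := ε) (show t ∉ movable μ p from fun h => ht h.1)]

/-- The family `ρ'` is as good a location as `ρ`, without being larger. Terminals that are proper
keep their column coordinate, because there the Eulerian condition is not available. -/
structure IsReduction (μ : S → S → ℝ) (ρ ρ' : ι → Pt S) : Prop where
  mem_P : ∀ i, ρ' i ∈ P μ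
  signedDinf_le : ∀ i j, signedDinf (ρ' i) (ρ' j) ≤ signedDinf (ρ i) (ρ j)
  zeroSet_subset : ∀ i, zeroSet (ρ i) ⊆ zeroSet (ρ' i)
  size_le : ∀ i, size (ρ' i) ≤ size (ρ i)
  inl_eq : ∀ i, ∀ s ∈ zeroSet (ρ i), IsProperTerminal μ s → ρ' i (Sum.inl s) = ρ i (Sum.inl s)

lemma isReduction_retract [Nonempty S] (hμ : ∀ s, μ s s = 0) (hρ : ∀ i, ρ i ∈ P μ) :
    IsReduction μ ρ fun i => retract μ (ρ i) := by
  have eq_zero (i : ι) {s : S} (hs : s ∈ zeroSet (ρ i)) :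
      retract μ (ρ i) (Sum.inl s) + retract μ (ρ i) (Sum.inr s) = 0 := by
    have : _ = _ := hs
    linarith [(retract_mem_Q μ (ρ i)).1 s s, hμ s, retract_le (hρ i) (Sum.inl s),
      retract_le (hρ i) (Sum.inr s)]
  refine ⟨fun i => (retract_mem_Q μ (ρ i)).1, fun i j => signedDinf_retract_le μ _ _,
    fun i s hs => eq_zero i hs, fun i => size_strictMono.monotone (retract_le (hρ i)),
    fun i s hs _ => ?_⟩
  have : _ = _ := hs
  linarith [eq_zero i hs, retract_le (hρ i) (Sum.inl s), retract_le (hρ i) (Sum.inr s)]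

lemma isReduction_push [Nonempty S] (hμ : IsDirectedDistance μ) {ε : ℝ} (hε : 0 ≤ ε)
    (hρ : ∀ i, ρ i ∈ Q μ) (hslack : ∀ i, Slack μ ε (ρ i)) :
    IsReduction μ ρ fun i => push μ ε (ρ i) where
  mem_P i := push_mem_P μ ε (ρ i)
  signedDinf_le i j := signedDinf_push_le hμ (hρ i) (hρ j) hε (hslack i) (hslack j)
  zeroSet_subset i := (zeroSet_push hμ (hρ i) hε (hslack i)).ge
  size_le i := size_push_le hμ (hρ i).1 hε (hslack i)
  inl_eq i s hs proper := by
    rw [push_of_not_colClosed (hρ i)]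
    exact fun colClosed => proper _ ⟨hρ i, hs⟩ ((isFat_iff hμ).2 ⟨hρ i, Or.inl colClosed⟩)

lemma IsReduction.of_swapPt (hμ : IsDirectedDistance μ)
    (h : IsReduction (Function.swap μ) (fun i => swapPt (ρ i)) ρ') :
    IsReduction μ ρ fun i => swapPt (ρ' i) where
  mem_P i := swapPt_mem_P.2 (h.mem_P i)
  signedDinf_le i j := by simpa using h.signedDinf_le j i
  zeroSet_subset i := by simpa using h.zeroSet_subset i
  size_le i := by simpa using h.size_le i
  inl_eq i s hs proper := by
    have inr_eq := h.inl_eq i s (by simpa using hs) (isProperTerminal_swap hμ proper)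
    have zero' : _ = _ := h.zeroSet_subset i (by simpa using hs)
    have zero : _ = _ := hs
    simp only [swapPt_inl] at inr_eq ⊢
    linarith

lemma exists_isReduction_size_lt_of_colClosed [Finite ι] [Nonempty S] (hμ : IsDirectedDistance μ)
    (hρ : ∀ i, ρ i ∈ Q μ) {i₀ : ι} (closed : ColClosed μ (ρ i₀))
    (not_covered : ¬ ColCovered μ (ρ i₀)) :
    ∃ ρ', IsReduction μ ρ ρ' ∧ size (ρ' i₀) < size (ρ i₀) := by
  have eventually_slack : ∀ᶠ ε in 𝓝[>] 0, ∀ i, Slack μ ε (ρ i) :=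
    eventually_all.2 fun i => eventually_slack hμ.2 (hρ i).1
  obtain ⟨ε, hslack, hε : 0 < ε⟩ := (eventually_slack.and self_mem_nhdsWithin).exists
  exact ⟨_, isReduction_push hμ hε.le hρ hslack,
    size_push_lt hμ (hρ i₀).1 hε (hslack i₀) closed not_covered⟩

lemma exists_isReduction_size_lt [Finite ι] [Nonempty S] (hμ : IsDirectedDistance μ)
    (hρ : ∀ i, ρ i ∈ Q μ) {i₀ : ι} (hfat : IsProperFat μ (ρ i₀)) :
    ∃ ρ', IsReduction μ ρ ρ' ∧ size (ρ' i₀) < size (ρ i₀) := by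
  obtain ⟨hfat, notMem_Qdeg⟩ := (isProperFat_iff hμ).1 hfat
  rw [mem_Qdeg_iff hμ.2] at notMem_Qdeg
  rcases ((isFat_iff hμ).1 hfat).2 with closed | closed
  · exact exists_isReduction_size_lt_of_colClosed hμ hρ closed
      fun covered => notMem_Qdeg ⟨hρ i₀, rfl, Or.inl ⟨closed, covered⟩⟩
  · obtain ⟨ρ', reduction, lt⟩ := exists_isReduction_size_lt_of_colClosed hμ.swap
      (ρ := fun i => swapPt (ρ i)) (fun i => swapPt_mem_Q.2 (hρ i)) closed
      fun covered => notMem_Qdeg ⟨hρ i₀, rfl, Or.inr ⟨closed, covered⟩⟩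
    exact ⟨_, reduction.of_swapPt hμ, by simpa using lt⟩

end Reduction

/-! ### Linear programming duality for packing problems -/

section Packing

open Matrix Filter

variable {E ι : Type*} [Fintype E] [Fintype ι] {A : Matrix E ι ℝ} {c : E → ℝ} {m : ι → ℝ}
  {l : E → ℝ} {f : ι → ℝ} {a b : ℝ}

/-- The Lagrangian of the packing problem of maximizing `m ⬝ᵥ f` over the vectors `f ≥ 0` with
`A *ᵥ f ≤ c`. The first variable is the multiplier of the packing constraint. -/
def lagrangian (A : Matrix E ι ℝ) (c : E → ℝ) (m : ι → ℝ) (l : E → ℝ) (f : ι → ℝ) : ℝ :=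
  c ⬝ᵥ l + m ⬝ᵥ f - l ⬝ᵥ A *ᵥ f

lemma lagrangian_transpose (A : Matrix E ι ℝ) (c : E → ℝ) (m : ι → ℝ) (l : E → ℝ) (f : ι → ℝ) :
    lagrangian Aᵀ m c f l = lagrangian A c m l f := by
  rw [lagrangian, lagrangian, mulVec_transpose, dotProduct_mulVec, dotProduct_comm f,
    add_comm (m ⬝ᵥ f)]

lemma lagrangian_eq (A : Matrix E ι ℝ) (c : E → ℝ) (m : ι → ℝ) (l : E → ℝ) (f : ι → ℝ) :
    lagrangian A c m l f = m ⬝ᵥ f + l ⬝ᵥ (c - A *ᵥ f) := by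
  rw [lagrangian, dotProduct_sub, dotProduct_comm c]
  ring

lemma lagrangian_add_single [DecidableEq E] (A : Matrix E ι ℝ) (c : E → ℝ) (m : ι → ℝ)
    (l : E → ℝ) (f : ι → ℝ) (e : E) (x : ℝ) :
    lagrangian A c m (l + Pi.single e x) f =
      lagrangian A c m l f + x * (c e - (A *ᵥ f) e) := by
  simp only [lagrangian_eq, add_dotProduct, single_dotProduct, Pi.sub_apply, add_assoc]

lemma lagrangian_combo (A : Matrix E ι ℝ) (c : E → ℝ) (m : ι → ℝ) (l l' : E → ℝ) (f : ι → ℝ)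
    (hab : a + b = 1) :
    lagrangian A c m (a • l + b • l') f = a * lagrangian A c m l f + b * lagrangian A c m l' f := by
  simp only [lagrangian_eq, add_dotProduct, smul_dotProduct, smul_eq_mul]
  linear_combination -(m ⬝ᵥ f) * hab

lemma continuous_lagrangian : Continuous fun x : (E → ℝ) × (ι → ℝ) =>
    lagrangian A c m x.1 x.2 := by
  unfold lagrangian
  fun_prop

lemma exists_isSaddlePointOn_lagrangian (A : Matrix E ι ℝ) (c : E → ℝ) (m : ι → ℝ) (ha : 0 ≤ a)
    (hb : 0 ≤ b) : ∃ l ∈ Set.Icc 0 (fun _ => a), ∃ f ∈ Set.Icc 0 (fun _ => b),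
      IsSaddlePointOn (Set.Icc 0 fun _ => a) (Set.Icc 0 fun _ => b) (lagrangian A c m) l f := by
  refine Sion.exists_isSaddlePointOn (Set.nonempty_Icc.2 fun _ => ha) (convex_Icc _ _)
    isCompact_Icc (fun f _ => ?_) (fun f _ => ?_) (convex_Icc _ _)
    (Set.nonempty_Icc.2 fun _ => hb) isCompact_Icc (fun l _ => ?_) (fun l _ => ?_)
  · exact (continuous_lagrangian.comp (.prodMk_left f)).lowerSemicontinuous.lowerSemicontinuousOn _
  · refine ConvexOn.quasiconvexOn ⟨convex_Icc _ _, fun l _ l' _ a b _ _ hab => ?_⟩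
    exact (lagrangian_combo A c m l l' f hab).le
  · exact (continuous_lagrangian.comp (.prodMk_right l)).upperSemicontinuous.upperSemicontinuousOn _
  · refine ConcaveOn.quasiconcaveOn ⟨convex_Icc _ _, fun f _ f' _ a b _ _ hab => ?_⟩
    simp only [← lagrangian_transpose A c m]
    exact (lagrangian_combo Aᵀ m c f f' l hab).ge

lemma exists_forall_lt_mul {κ : Type*} [Finite κ] (x y : κ → ℝ) :
    ∃ a, 0 ≤ a ∧ ∀ k, 0 < x k → y k < a * x k := by
  have eventually_lt : ∀ᶠ a in atTop, ∀ k, 0 < x k → y k < a * x k :=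
    eventually_all.2 fun k => eventually_imp_distrib_left.2 fun hk =>
      (tendsto_id.atTop_mul_const hk).eventually_gt_atTop (y k)
  exact ((eventually_ge_atTop 0).and eventually_lt).exists

lemma add_single_sub_mem_Icc {κ : Type*} [DecidableEq κ] {g : κ → ℝ}
    (hg : g ∈ Set.Icc 0 fun _ => a) (k : κ) {x : ℝ} (hx : x ∈ Set.Icc 0 a) :
    g + Pi.single k (x - g k) ∈ Set.Icc 0 fun _ => a := by
  constructor <;> intro j <;> rcases eq_or_ne j k with rfl | hne
  · simpa using hx.1
  · simpa [hne] using hg.1 j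
  · simpa using hx.2
  · simpa [hne] using hg.2 j

section SaddlePoint

variable (hl : l ∈ Set.Icc 0 fun _ => a) (hf : f ∈ Set.Icc 0 fun _ => b)
  (saddle : IsSaddlePointOn (Set.Icc 0 fun _ => a) (Set.Icc 0 fun _ => b) (lagrangian A c m) l f)

include hl hf saddle

lemma sub_mul_slack_nonneg (e : E) {x : ℝ} (hx : x ∈ Set.Icc 0 a) :
    0 ≤ (x - l e) * (c e - (A *ᵥ f) e) := by
  classical
  have le := saddle _ (add_single_sub_mem_Icc hl e hx) _ hf
  rwa [lagrangian_add_single, le_add_iff_nonneg_right] at le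

lemma sub_mul_excess_nonpos (i : ι) {y : ℝ} (hy : y ∈ Set.Icc 0 b) :
    (y - f i) * (m i - (l ᵥ* A) i) ≤ 0 := by
  classical
  have le := saddle _ hl _ (add_single_sub_mem_Icc hf i hy)
  rwa [← lagrangian_transpose, ← lagrangian_transpose A, lagrangian_add_single,
    add_le_iff_nonpos_right, mulVec_transpose] at le

variable (hA : ∀ e i, 0 ≤ A e i)

include hA

/-- On a box of large side length a saddle point solves both linear programs: a violated
constraint would push the corresponding multiplier to the boundary, which is too expensive. -/
lemma le_vecMul_of_isSaddlePointOn (hcol : ∀ i, ∃ e, 0 < A e i)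
    (ha : ∀ e i, 0 < A e i → m i < a * A e i) (hb : ∀ e i, 0 < A e i → c e < b * A e i) :
    m ≤ l ᵥ* A := by
  intro i
  by_contra! violated
  obtain ⟨e, he⟩ := hcol i
  have a_nonneg : 0 ≤ a := (hl.1 e).trans (hl.2 e)
  have b_nonneg : 0 ≤ b := (hf.1 i).trans (hf.2 i)
  have b_le : b ≤ f i := by
    have := sub_mul_excess_nonpos hl hf saddle i (Set.right_mem_Icc.2 b_nonneg)
    exact sub_nonpos.1 (nonpos_of_mul_nonpos_left this (sub_pos.2 violated))
  have l_lt : l e < a := by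
    have : l e * A e i ≤ (l ᵥ* A) i :=
      Finset.single_le_sum (f := fun e => l e * A e i) (fun e _ => mul_nonneg (hl.1 e) (hA e i))
        (Finset.mem_univ e)
    exact lt_of_mul_lt_mul_right (this.trans_lt (violated.trans (ha e i he))) he.le
  have c_lt : c e < (A *ᵥ f) e := by
    have : A e i * f i ≤ (A *ᵥ f) e :=
      Finset.single_le_sum (f := fun i => A e i * f i) (fun i _ => mul_nonneg (hA e i) (hf.1 i))
        (Finset.mem_univ i)
    nlinarith [hb e i he]
  have := sub_mul_slack_nonneg hl hf saddle e (Set.right_mem_Icc.2 a_nonneg)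
  exact this.not_gt (mul_neg_of_pos_of_neg (sub_pos.2 l_lt) (sub_neg.2 c_lt))

lemma mulVec_le_of_isSaddlePointOn (hc : 0 ≤ c) (ha : ∀ e i, 0 < A e i → m i < a * A e i) :
    A *ᵥ f ≤ c := by
  intro e
  by_contra! violated
  have a_nonneg : 0 ≤ a := (hl.1 e).trans (hl.2 e)
  have a_le : a ≤ l e := by
    have := sub_mul_slack_nonneg hl hf saddle e (Set.right_mem_Icc.2 a_nonneg)
    exact sub_nonpos.1 (nonpos_of_mul_nonneg_left this (sub_neg.2 violated))
  obtain ⟨i, -, hi⟩ : ∃ i ∈ Finset.univ, 0 < A e i * f i :=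
    Finset.exists_lt_of_sum_lt (Finset.sum_const_zero.trans_lt ((hc e).trans_lt violated))
  have f_pos : 0 < f i := pos_of_mul_pos_right hi (hA e i)
  have A_pos : 0 < A e i := pos_of_mul_pos_left hi (hf.1 i)
  have m_lt : m i < (l ᵥ* A) i := by
    have : l e * A e i ≤ (l ᵥ* A) i :=
      Finset.single_le_sum (f := fun e => l e * A e i) (fun e _ => mul_nonneg (hl.1 e) (hA e i))
        (Finset.mem_univ e)
    nlinarith [ha e i A_pos]
  have := sub_mul_excess_nonpos hl hf saddle i (Set.left_mem_Icc.2 ((hf.1 i).trans (hf.2 i)))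
  exact this.not_gt (mul_pos_of_neg_of_neg (by linarith) (sub_neg.2 m_lt))

end SaddlePoint

lemma exists_packing_dual (hA : ∀ e i, 0 ≤ A e i) (hcol : ∀ i, ∃ e, 0 < A e i) (hc : 0 ≤ c)
    (m : ι → ℝ) : ∃ f l, 0 ≤ f ∧ A *ᵥ f ≤ c ∧ 0 ≤ l ∧ m ≤ l ᵥ* A ∧ c ⬝ᵥ l ≤ m ⬝ᵥ f := by
  obtain ⟨a, a_nonneg, ha⟩ :=
    exists_forall_lt_mul (fun k : E × ι => A k.1 k.2) (fun k => m k.2)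
  obtain ⟨b, b_nonneg, hb⟩ :=
    exists_forall_lt_mul (fun k : E × ι => A k.1 k.2) (fun k => c k.1)
  obtain ⟨l, hl, f, hf, saddle⟩ := exists_isSaddlePointOn_lagrangian A c m a_nonneg b_nonneg
  refine ⟨f, l, hf.1, mulVec_le_of_isSaddlePointOn hl hf saddle hA hc fun e i => ha (e, i), hl.1,
    le_vecMul_of_isSaddlePointOn hl hf saddle hA hcol (fun e i => ha (e, i)) fun e i => hb (e, i),
    ?_⟩
  simpa [lagrangian] using
    saddle 0 (Set.left_mem_Icc.2 fun _ => a_nonneg) 0 (Set.left_mem_Icc.2 fun _ => b_nonneg)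

end Packing

/-! ### Paths, walks and optimal multiflows -/

section Paths

variable {S V : Type*} {N : Network S V} {w : N.edges → ℝ} {x y z : V} {l : List V} {r r' M : ℝ}

instance (N : Network S V) [Finite S] [Finite V] : Finite (SPath N) := by
  have := Fintype.ofFinite V
  refine Finite.of_injective (β := {l : List V // l.Nodup} × S × S)
    (fun P => (⟨P.nodes, P.nodup⟩, P.source, P.target)) ?_
  rintro ⟨⟩ ⟨⟩ h
  simp only [Prod.mk.injEq, Subtype.mk.injEq] at h
  obtain ⟨rfl, rfl, rfl⟩ := h
  rfl

/-- `l` is the list of nodes of a directed path from `x` to `y`. In contrast to `SPath`, the ends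
need not be terminals and may coincide. -/
structure IsPath (N : Network S V) (x y : V) (l : List V) : Prop where
  head_eq : l.head? = some x
  last_eq : l.getLast? = some y
  nodup : l.Nodup
  chain : l.IsChain (fun x y => (x, y) ∈ N.edges)

lemma SPath.isPath (p : SPath N) :
    IsPath N (N.terminal p.source) (N.terminal p.target) p.nodes :=
  ⟨p.head_eq, p.last_eq, p.nodup, p.chain⟩

lemma isPath_singleton : IsPath N x y [z] ↔ z = x ∧ z = y :=
  ⟨fun h => ⟨by simpa using h.head_eq, by simpa using h.last_eq⟩,
    fun ⟨hx, hy⟩ => ⟨by simp [hx], by simp [hy], by simp, by simp⟩⟩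

lemma isPath_cons_cons {a b : V} : IsPath N x z (a :: b :: l) ↔
    a = x ∧ a ∉ b :: l ∧ (a, b) ∈ N.edges ∧ IsPath N b z (b :: l) := by
  constructor
  · rintro ⟨head, last, nodup, chain⟩
    rw [List.isChain_cons_cons] at chain
    exact ⟨by simpa using head, (List.nodup_cons.1 nodup).1, chain.1, rfl, by simpa using last,
      (List.nodup_cons.1 nodup).2, chain.2⟩
  · rintro ⟨rfl, notMem, edge, -, last, nodup, chain⟩
    exact ⟨rfl, by simpa using last, nodup.cons notMem, chain.cons_cons edge⟩

lemma IsPath.exists_suffix (h : IsPath N x z l) (hy : y ∈ l) :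
    ∃ l', l' <:+ l ∧ IsPath N y z l' := by
  obtain ⟨l₁, l₂, rfl⟩ := List.append_of_mem hy
  have suffix : y :: l₂ <:+ l₁ ++ y :: l₂ := List.suffix_append _ _
  exact ⟨y :: l₂, suffix, rfl, by simpa using h.last_eq, h.nodup.sublist suffix.sublist,
    h.chain.suffix suffix⟩

open Classical in
/-- The total length of the edges joining consecutive nodes of `l`, each edge counted once. -/
def pathLength (w : N.edges → ℝ) (l : List V) : ℝ :=
  ∑ e : N.edges with [e.1.1, e.1.2] <:+: l, w e

lemma pathLength_singleton (w : N.edges → ℝ) (x : V) : pathLength w [x] = 0 := by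
  classical
  refine Finset.sum_eq_zero fun e he => ?_
  simpa using (Finset.mem_filter.1 he).2.length_le

lemma SPath.pathLength_nodes (p : SPath N) (w : N.edges → ℝ)
    [DecidablePred fun e : N.edges => p.Uses e.1] :
    pathLength w p.nodes = ∑ e : N.edges with p.Uses e.1, w e :=
  Finset.sum_congr (Finset.ext fun e => by simp only [Finset.mem_filter]; rfl) fun _ _ => rfl

lemma pathLength_le_of_infix (hw : ∀ e, 0 ≤ w e) {l l' : List V} (h : l <:+: l') :
    pathLength w l ≤ pathLength w l' := by
  classical
  exact Finset.sum_le_sum_of_subset_of_nonneg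
    (Finset.monotone_filter_right _ fun _ _ infix_l => infix_l.trans h) fun e _ _ => hw e

lemma pathLength_cons_cons {a b : V} (h : (a, b) ∈ N.edges) (ha : a ∉ b :: l) :
    pathLength w (a :: b :: l) = w ⟨(a, b), h⟩ + pathLength w (b :: l) := by
  classical
  have pair_infix (e : N.edges) :
      [e.1.1, e.1.2] <:+: a :: b :: l ↔ e = ⟨(a, b), h⟩ ∨ [e.1.1, e.1.2] <:+: b :: l := by
    simp [List.infix_cons_iff (l₂ := b :: l), List.cons_prefix_cons, Subtype.ext_iff, Prod.ext_iff]
  simp only [pathLength, pair_infix]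
  rw [Finset.filter_or, Finset.filter_eq', if_pos (Finset.mem_univ _),
    Finset.sum_union (Finset.disjoint_singleton_left.2 _), Finset.sum_singleton]
  exact fun he => ha ((Finset.mem_filter.1 he).2.subset (by simp))

lemma IsPath.sub_le_pathLength {g : V → ℝ}
    (hg : ∀ e : N.edges, g e.1.2 - g e.1.1 ≤ w e) (h : IsPath N x y l) :
    g y - g x ≤ pathLength w l := by
  induction l generalizing x with
  | nil => simpa using h.head_eq
  | cons a l ih =>
    cases l with
    | nil =>
      obtain ⟨rfl, rfl⟩ := isPath_singleton.1 h
      simp [pathLength_singleton]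
    | cons b l =>
      obtain ⟨rfl, notMem, edge, tail⟩ := isPath_cons_cons.1 h
      rw [pathLength_cons_cons edge notMem]
      linarith [ih tail, hg ⟨(a, b), edge⟩]

/-- There is a walk of length `r` from one node to the other, with repetitions counted. -/
inductive WalkLength (w : N.edges → ℝ) : V → V → ℝ → Prop
  | refl (x : V) : WalkLength w x x 0
  | cons {x y z : V} {r : ℝ} (he : (x, y) ∈ N.edges) (h : WalkLength w y z r) :
      WalkLength w x z (w ⟨(x, y), he⟩ + r)

namespace WalkLength

lemma edge (w : N.edges → ℝ) (e : N.edges) : WalkLength w e.1.1 e.1.2 (w e) := by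
  simpa using WalkLength.cons (w := w) e.2 (.refl _)

lemma trans (h : WalkLength w x y r) (h' : WalkLength w y z r') : WalkLength w x z (r + r') := by
  induction h with
  | refl => simpa using h'
  | cons he _ ih =>
    rw [add_assoc]
    exact (ih h').cons he

lemma nonneg (hw : ∀ e, 0 ≤ w e) (h : WalkLength w x y r) : 0 ≤ r := by
  induction h with
  | refl => exact le_rfl
  | cons he _ ih => exact add_nonneg (hw _) ih

lemma exists_isPath (hw : ∀ e, 0 ≤ w e) (h : WalkLength w x y r) :
    ∃ l, IsPath N x y l ∧ pathLength w l ≤ r := by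
  induction h with
  | refl x => exact ⟨[x], isPath_singleton.2 ⟨rfl, rfl⟩, (pathLength_singleton w x).le⟩
  | @cons x y z r he _ ih =>
    obtain ⟨l, path, le⟩ := ih
    by_cases hx : x ∈ l
    · obtain ⟨l', suffix, path'⟩ := path.exists_suffix hx
      have := pathLength_le_of_infix hw suffix.isInfix
      exact ⟨l', path', by linarith [hw ⟨(x, y), he⟩]⟩
    · obtain ⟨l, rfl⟩ := List.head?_eq_some_iff.1 path.head_eq
      refine ⟨x :: y :: l, isPath_cons_cons.2 ⟨rfl, hx, he, path⟩, ?_⟩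
      rw [pathLength_cons_cons he hx]
      gcongr

end WalkLength

/-- The distance from `x` to `y` with respect to the edge lengths `w`, truncated at `M`. The
truncation gives a value to pairs of nodes that are not joined by a walk. -/
def truncDist (w : N.edges → ℝ) (M : ℝ) (x y : V) : ℝ :=
  sInf (insert M {r | WalkLength w x y r})

lemma le_truncDist (hM : r ≤ M) (h : ∀ r', WalkLength w x y r' → r ≤ r') :
    r ≤ truncDist w M x y := by
  refine le_csInf (Set.insert_nonempty _ _) ?_
  rintro r' (rfl | walk)
  exacts [hM, h r' walk]

section Nonneg

variable (hw : ∀ e, 0 ≤ w e) (hM : 0 ≤ M)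

include hw hM

lemma truncDist_nonneg (x y : V) : 0 ≤ truncDist w M x y :=
  le_truncDist hM fun _ walk => walk.nonneg hw

lemma bddBelow_insert_walkLength (x y : V) : BddBelow (insert M {r | WalkLength w x y r}) := by
  refine ⟨0, ?_⟩
  rintro r (rfl | walk)
  exacts [hM, walk.nonneg hw]

lemma truncDist_le_trunc (x y : V) : truncDist w M x y ≤ M :=
  csInf_le (bddBelow_insert_walkLength hw hM x y) (Set.mem_insert _ _)

lemma WalkLength.truncDist_le (h : WalkLength w x y r) : truncDist w M x y ≤ r :=
  csInf_le (bddBelow_insert_walkLength hw hM x y) (Set.mem_insert_of_mem _ h)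

lemma truncDist_self (x : V) : truncDist w M x x = 0 :=
  le_antisymm ((WalkLength.refl x).truncDist_le hw hM) (truncDist_nonneg hw hM x x)

lemma truncDist_sub_truncDist_le_right (x : V) (e : N.edges) :
    truncDist w M x e.1.2 - truncDist w M x e.1.1 ≤ w e := by
  rw [sub_le_comm]
  refine le_truncDist ?_ fun r walk => ?_
  · linarith [hw e, truncDist_le_trunc hw hM x e.1.2]
  · linarith [(walk.trans (.edge w e)).truncDist_le hw hM]

lemma truncDist_sub_truncDist_le_left (x : V) (e : N.edges) :
    truncDist w M e.1.1 x - truncDist w M e.1.2 x ≤ w e := by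
  rw [sub_le_comm]
  refine le_truncDist ?_ fun r walk => ?_
  · linarith [hw e, truncDist_le_trunc hw hM e.1.1 x]
  · linarith [(walk.cons e.2).truncDist_le hw hM]

end Nonneg

variable {μ : S → S → ℝ}

lemma SPath.exists_uses (p : SPath N) : ∃ e : N.edges, p.Uses e.1 := by
  obtain ⟨nodes, s, t, hst, head, last, -, chain⟩ := p
  rcases nodes with _ | ⟨x, _ | ⟨y, l⟩⟩
  · simp at head
  · simp only [List.head?_cons, Option.some.injEq, List.getLast?_singleton] at head last
    exact absurd (N.terminal.injective (head.symm.trans last)) hst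
  · exact ⟨⟨(x, y), (List.isChain_cons_cons.1 chain).1⟩, [], l, rfl⟩

lemma Multiflow.val_le (f : Multiflow N) (hw : ∀ e, 0 ≤ w e)
    (h : ∀ p : SPath N, μ p.source p.target ≤ pathLength w p.nodes) :
    f.val μ ≤ ∑ e, (N.cap e : ℝ) * w e := by
  classical
  calc f.val μ ≤ ∑ p ∈ f.paths, (f.flow p : ℝ) * pathLength w p.nodes :=
        Finset.sum_le_sum fun p _ => mul_le_mul_of_nonneg_left (h p) (f.flow p).2
    _ = ∑ e : N.edges, (∑ p ∈ f.paths with p.Uses e.1, (f.flow p : ℝ)) * w e := by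
        simp only [SPath.pathLength_nodes, Finset.mul_sum, Finset.sum_mul, Finset.sum_filter,
          mul_ite, ite_mul, zero_mul, mul_zero]
        exact Finset.sum_comm
    _ ≤ _ := Finset.sum_le_sum fun e _ => mul_le_mul_of_nonneg_right (f.capacity e) (hw e)

open Matrix in
lemma exists_isMFPOpt [Finite S] [Finite V] (μ : S → S → ℝ) (N : Network S V) :
    ∃ v, IsMFPOpt μ N v ∧ ∃ w : N.edges → ℝ, (∀ e, 0 ≤ w e) ∧
      (∀ p : SPath N, μ p.source p.target ≤ pathLength w p.nodes) ∧
      ∑ e, (N.cap e : ℝ) * w e ≤ v := by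
  classical
  have := Fintype.ofFinite (SPath N)
  let A : Matrix N.edges (SPath N) ℝ := .of fun e p => if p.Uses e.1 then 1 else 0
  obtain ⟨f, w, f_nonneg, Af_le, w_nonneg, le_wA, le⟩ := exists_packing_dual (A := A)
    (c := fun e => N.cap e) (fun e p => by simp only [A, of_apply]; positivity)
    (fun p => p.exists_uses.imp fun e he => by simp [A, he]) (fun e => Nat.cast_nonneg _)
    (fun p => μ p.source p.target)
  have le_length (p : SPath N) : μ p.source p.target ≤ pathLength w p.nodes := by
    simpa only [p.pathLength_nodes, Finset.sum_filter, A, vecMul, dotProduct, of_apply, mul_ite,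
      mul_one, mul_zero] using le_wA p
  lift f to SPath N → ℝ≥0 using f_nonneg
  let F : Multiflow N := ⟨Finset.univ, f, fun e => by
    simpa only [Finset.sum_filter, A, mulVec, dotProduct, of_apply, ite_mul, one_mul, zero_mul]
      using Af_le e⟩
  have le_val : ∑ e, (N.cap e : ℝ) * w e ≤ F.val μ :=
    le.trans_eq (Finset.sum_congr rfl fun p _ => mul_comm _ _)
  refine ⟨F.val μ, ⟨⟨F, rfl⟩, ?_⟩, w, w_nonneg, le_length, le_val⟩
  rintro _ ⟨g, rfl⟩
  exact (g.val_le w_nonneg le_length).trans le_val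

end Paths

/-! ### Facility location with signed distances -/

section Location

variable {S V : Type*} {μ : S → S → ℝ} {N : Network S V} {R R' : Set (Pt S)} {ρ ρ' : V → Pt S}
  {h : V → ℝ} {p : Pt S} {s : S}

lemma flpFeasible_iff :
    FLPFeasible R N ρ ↔ (∀ x, ρ x ∈ R) ∧ ∀ s, s ∈ zeroSet (ρ (N.terminal s)) :=
  ⟨fun hρ => ⟨hρ.1, fun s => (hρ.2 s).2⟩, fun hρ => ⟨hρ.1, fun s => ⟨hρ.1 _, hρ.2 s⟩⟩⟩

lemma FLPFeasible.mono (hR : R ⊆ R') (hρ : FLPFeasible R N ρ) : FLPFeasible R' N ρ :=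
  ⟨fun x => hR (hρ.1 x), fun s => ⟨hR (hρ.1 _), (hρ.2 s).2⟩⟩

lemma eq_zero_of_mem_zeroSet (hp : ∀ u, 0 ≤ p u) (hs : s ∈ zeroSet p) :
    p (Sum.inl s) = 0 ∧ p (Sum.inr s) = 0 :=
  (add_eq_zero_iff_of_nonneg (hp _) (hp _)).1 hs

lemma inl_nonneg_of_mem_zeroSet (hμ : ∀ s t, 0 ≤ μ s t) (hp : p ∈ P μ) (hs : s ∈ zeroSet p)
    (h0 : p (Sum.inl s) = 0) (t : S) : 0 ≤ p (Sum.inl t) := by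
  have hs : _ = _ := hs
  linarith [hp t s, hμ t s]

lemma FLPFeasible.eq_zero (hρ : FLPFeasible (posPart R) N ρ) (s : S) :
    ρ (N.terminal s) (Sum.inl s) = 0 ∧ ρ (N.terminal s) (Sum.inr s) = 0 :=
  eq_zero_of_mem_zeroSet (hρ.1 _).2 (hρ.2 s).2

/-- The objective value of the facility location problem with `signedDinf` in place of `Dinf`. -/
def signedCost (N : Network S V) (ρ : V → Pt S) : ℝ :=
  ∑ e : N.edges, (N.cap e : ℝ) * signedDinf (ρ e.1.1) (ρ e.1.2)

lemma signedCost_le_of_signedDinf_le (N : Network S V)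
    (h : ∀ x y, signedDinf (ρ' x) (ρ' y) ≤ signedDinf (ρ x) (ρ y)) :
    signedCost N ρ' ≤ signedCost N ρ :=
  Finset.sum_le_sum fun _ _ => mul_le_mul_of_nonneg_left (h _ _) (Nat.cast_nonneg _)

lemma FLPFeasible.FLPCost_eq_signedCost [Finite S] [Nonempty S] (hρ : FLPFeasible R N ρ)
    (hR : IsBalanced R) : FLPCost N ρ = signedCost N ρ :=
  Finset.sum_congr rfl fun _ _ => by rw [hR.Dinf_eq_signedDinf (hρ.1 _) (hρ.1 _)]

lemma continuous_signedCost [Finite S] [Nonempty S] (N : Network S V) :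
    Continuous (signedCost N) :=
  continuous_finsetSum _ fun e _ => continuous_const.mul
    (continuous_signedDinf.comp (f := fun ρ : V → Pt S => (ρ e.1.1, ρ e.1.2)) (by fun_prop))

open Classical in
lemma sum_cap_mul_apply [Fintype V] (N : Network S V) (h : V → ℝ) (g : N.edges → V) :
    ∑ e, (N.cap e : ℝ) * h (g e) = ∑ x, ((∑ e with g e = x, N.cap e : ℕ) : ℝ) * h x := by
  rw [← Finset.sum_fiberwise (g := g)]
  refine Finset.sum_congr rfl fun x _ => ?_
  rw [Nat.cast_sum, Finset.sum_mul]
  exact Finset.sum_congr rfl fun e he => by rw [(Finset.mem_filter.1 he).2]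

lemma sum_cap_mul_sub_eq_zero [Finite V] (hh : ∀ x, h x = 0 ∨ N.EulerianAt x) :
    ∑ e, (N.cap e : ℝ) * (h e.1.2 - h e.1.1) = 0 := by
  have := Fintype.ofFinite V
  simp only [mul_sub, Finset.sum_sub_distrib]
  rw [sum_cap_mul_apply N h (fun e => e.1.2), sum_cap_mul_apply N h (fun e => e.1.1),
    ← Finset.sum_sub_distrib]
  refine Finset.sum_eq_zero fun x _ => ?_
  rcases hh x with h_zero | eulerian
  · simp [h_zero]
  · rw [eulerian, sub_self]

lemma signedCost_le_of_signedDinf_le_add [Finite V] (hh : ∀ x, h x = 0 ∨ N.EulerianAt x)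
    (hle : ∀ x y, signedDinf (ρ' x) (ρ' y) ≤ signedDinf (ρ x) (ρ y) + (h y - h x)) :
    signedCost N ρ' ≤ signedCost N ρ :=
  calc signedCost N ρ'
      ≤ ∑ e : N.edges, (N.cap e : ℝ) *
          (signedDinf (ρ e.1.1) (ρ e.1.2) + (h e.1.2 - h e.1.1)) :=
        Finset.sum_le_sum fun e _ => mul_le_mul_of_nonneg_left (hle _ _) (Nat.cast_nonneg _)
    _ = signedCost N ρ := by
        simp only [mul_add, Finset.sum_add_distrib, sum_cap_mul_sub_eq_zero hh, add_zero,
          signedCost]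

lemma signedCost_translate [Finite S] [Nonempty S] [Finite V]
    (hh : ∀ x, h x = 0 ∨ N.EulerianAt x) (ρ : V → Pt S) :
    signedCost N (fun x => translate (ρ x) (h x)) = signedCost N ρ := by
  simp only [signedCost, signedDinf_translate, mul_add, Finset.sum_add_distrib,
    sum_cap_mul_sub_eq_zero hh, add_zero]

lemma Network.ProperlyInnerEulerian.eq_zero_or_eulerianAt (hN : N.ProperlyInnerEulerian μ)
    (hh : ∀ s, IsProperTerminal μ s → h (N.terminal s) = 0) (x : V) :
    h x = 0 ∨ N.EulerianAt x := by
  refine or_iff_not_imp_right.2 fun not_eulerian => ?_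
  obtain ⟨s, rfl, proper⟩ := not_not.1 (mt (hN x) not_eulerian)
  exact hh s proper

/-! ### Locations of minimal size -/

lemma isClosed_posPart_P (μ : S → S → ℝ) : IsClosed (posPart (P μ)) := by
  simp only [posPart, P, Set.ofPred_and, Set.ofPred_forall]
  exact .inter
    (isClosed_iInter fun s => isClosed_iInter fun t => isClosed_le (by fun_prop) (by fun_prop))
    (isClosed_iInter fun u => isClosed_le continuous_const (continuous_apply u))

lemma isClosed_setOf_flpFeasible (μ : S → S → ℝ) (N : Network S V) :
    IsClosed {ρ | FLPFeasible (posPart (P μ)) N ρ} := by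
  simp only [flpFeasible_iff, zeroSet, Set.mem_ofPred_eq, Set.ofPred_and, Set.ofPred_forall]
  exact .inter (isClosed_iInter fun x => (isClosed_posPart_P μ).preimage (continuous_apply x))
    (isClosed_iInter fun s => isClosed_eq (by fun_prop) (by fun_prop))

lemma apply_le_size [Fintype S] (hp : ∀ u, 0 ≤ p u) (u : S ⊕ S) : p u ≤ size p := by
  rw [size, Finset.sum_add_distrib, ← Fintype.sum_sum_type]
  exact Finset.single_le_sum (fun u _ => hp u) (Finset.mem_univ u)

lemma size_nonneg [Fintype S] (hp : ∀ u, 0 ≤ p u) : 0 ≤ size p :=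
  Finset.sum_nonneg fun _ _ => add_nonneg (hp _) (hp _)

lemma exists_flpFeasible_minimal_size [Fintype S] [Nonempty S] [Fintype V]
    (hρ : FLPFeasible (posPart (P μ)) N ρ) :
    ∃ ρ₀, FLPFeasible (posPart (P μ)) N ρ₀ ∧ signedCost N ρ₀ ≤ signedCost N ρ ∧
      ∀ ρ', FLPFeasible (posPart (P μ)) N ρ' → signedCost N ρ' ≤ signedCost N ρ₀ →
        ∑ x, size (ρ₀ x) ≤ ∑ x, size (ρ' x) := by
  let total (ρ : V → Pt S) : ℝ := ∑ x, size (ρ x)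
  have continuous_total : Continuous total :=
    continuous_finsetSum _ fun x _ => continuous_size.comp (continuous_apply x)
  let F : Set (V → Pt S) := {ρ' | FLPFeasible (posPart (P μ)) N ρ'} ∩
    {ρ' | signedCost N ρ' ≤ signedCost N ρ} ∩ {ρ' | total ρ' ≤ total ρ}
  have closed : IsClosed F := ((isClosed_setOf_flpFeasible μ N).inter
    (isClosed_le (continuous_signedCost N) continuous_const)).inter
    (isClosed_le continuous_total continuous_const)
  have bounded : F ⊆ Set.Icc 0 fun _ _ => total ρ := fun ρ' ⟨⟨feasible, _⟩, total_le⟩ =>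
    ⟨fun x => (feasible.1 x).2, fun x u => (apply_le_size (feasible.1 x).2 u).trans
      ((Finset.single_le_sum (f := fun x => size (ρ' x))
        (fun x _ => size_nonneg (feasible.1 x).2) (Finset.mem_univ x)).trans total_le)⟩
  obtain ⟨ρ₀, ⟨⟨feasible, cost_le⟩, total_le⟩, minimal⟩ :=
    (isCompact_Icc.of_isClosed_subset closed bounded).exists_isMinOn
      ⟨ρ, ⟨hρ, le_refl (signedCost N ρ)⟩, le_refl (total ρ)⟩
      continuous_total.continuousOn
  refine ⟨ρ₀, feasible, cost_le, fun ρ' feasible' cost_le' => ?_⟩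
  rcases le_total (total ρ') (total ρ) with le | le
  · exact minimal ⟨⟨feasible', cost_le'.trans cost_le⟩, le⟩
  · exact total_le.trans le

section Reduction

variable [Fintype S] (hμ : IsDirectedDistance μ) (hN : N.ProperlyInnerEulerian μ)
  (hρ : FLPFeasible (posPart (P μ)) N ρ) (hρ' : IsReduction μ ρ ρ')

include hμ hρ hρ' in
lemma IsReduction.flpFeasible_normalize :
    FLPFeasible (posPart (P μ)) N fun x => normalize (ρ' x) :=
  flpFeasible_iff.2 ⟨fun x => ⟨translate_mem_P (hρ'.mem_P x) _,
    fun u => normalize_nonneg hμ.1 (hρ'.mem_P x) u⟩, fun s => by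
      simpa only [normalize, zeroSet_translate] using hρ'.zeroSet_subset _ (hρ.2 s).2⟩

variable [Nonempty S] [Finite V]

include hμ hN hρ hρ' in
lemma IsReduction.signedCost_normalize_le :
    signedCost N (fun x => normalize (ρ' x)) ≤ signedCost N ρ := by
  have proper_zero (s : S) (hs : IsProperTerminal μ s) :
      -⨅ t, ρ' (N.terminal s) (Sum.inl t) = 0 := by
    have inl_zero := (hρ'.inl_eq _ s (hρ.2 s).2 hs).trans (hρ.eq_zero s).1
    rw [neg_eq_zero]
    exact iInf_inl_eq_zero (inl_nonneg_of_mem_zeroSet hμ.1 (hρ'.mem_P _)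
      (hρ'.zeroSet_subset _ (hρ.2 s).2) inl_zero) inl_zero
  calc signedCost N (fun x => normalize (ρ' x)) = signedCost N ρ' :=
        signedCost_translate (hN.eq_zero_or_eulerianAt proper_zero) ρ'
    _ ≤ signedCost N ρ := signedCost_le_of_signedDinf_le N hρ'.signedDinf_le

end Reduction

lemma exists_flpFeasible_Qslim [Finite S] [Nonempty S] [Finite V] (hμ : IsDirectedDistance μ)
    (hN : N.ProperlyInnerEulerian μ) (hρ : FLPFeasible (posPart (P μ)) N ρ) :
    ∃ ρ₀, FLPFeasible (posPart (Qslim μ)) N ρ₀ ∧ signedCost N ρ₀ ≤ signedCost N ρ := by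
  have := Fintype.ofFinite S
  have := Fintype.ofFinite V
  obtain ⟨ρ₀, feasible, cost_le, minimal⟩ := exists_flpFeasible_minimal_size hρ
  have irreducible (ρ' : V → Pt S) (hρ' : IsReduction μ ρ₀ ρ') (x : V) :
      size (ρ' x) = size (ρ₀ x) := by
    have total_le := minimal _ (hρ'.flpFeasible_normalize hμ feasible)
      (hρ'.signedCost_normalize_le hμ hN feasible)
    simp only [normalize, size_translate] at total_le
    exact (Finset.sum_eq_sum_iff_of_le fun x _ => hρ'.size_le x).1
      ((Finset.sum_le_sum fun x _ => hρ'.size_le x).antisymm total_le) x (Finset.mem_univ x)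
  have mem_Q (x : V) : ρ₀ x ∈ Q μ := by
    have mem_P (x : V) : ρ₀ x ∈ P μ := (feasible.1 x).1
    have retract_eq : retract μ (ρ₀ x) = ρ₀ x := eq_of_le_of_not_lt (retract_le (mem_P x))
      fun lt => (size_strictMono lt).ne (irreducible _ (isReduction_retract hμ.2 mem_P) x)
    exact retract_eq ▸ retract_mem_Q μ (ρ₀ x)
  have not_isProperFat (x : V) : ¬ IsProperFat μ (ρ₀ x) := fun fat => by
    obtain ⟨ρ', reduction, size_lt⟩ := exists_isReduction_size_lt hμ mem_Q fat
    exact size_lt.ne (irreducible ρ' reduction x)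
  exact ⟨ρ₀, flpFeasible_iff.2 ⟨fun x => ⟨⟨mem_Q x, not_isProperFat x⟩, (feasible.1 x).2⟩,
    (flpFeasible_iff.1 feasible).2⟩, cost_le⟩

/-! ### Locations and edge lengths -/

/-- The point of the distances to and from the terminals, which locates the node `x` when `w` is an
optimal solution of the dual of the multiflow problem. -/
def distPt (N : Network S V) (w : N.edges → ℝ) (M : ℝ) (x : V) : Pt S :=
  Sum.elim (fun s => truncDist w M (N.terminal s) x) (fun s => truncDist w M x (N.terminal s))

variable {w : N.edges → ℝ} {M : ℝ}

lemma WalkLength.le_of_le_pathLength (hμ : IsDirectedDistance μ) (hw : ∀ e, 0 ≤ w e)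
    (hle : ∀ p : SPath N, μ p.source p.target ≤ pathLength w p.nodes) {s t : S} {r : ℝ}
    (h : WalkLength w (N.terminal s) (N.terminal t) r) : μ s t ≤ r := by
  rcases eq_or_ne s t with rfl | hne
  · exact (hμ.2 s).trans_le (h.nonneg hw)
  · obtain ⟨l, path, length_le⟩ := h.exists_isPath hw
    exact (hle ⟨l, s, t, hne, path.head_eq, path.last_eq, path.nodup, path.chain⟩).trans length_le

lemma distPt_mem_P (hw : ∀ e, 0 ≤ w e) (hM : ∀ s t, μ s t ≤ M) (hM₀ : 0 ≤ M)
    (hle : ∀ s t r, WalkLength w (N.terminal s) (N.terminal t) r → μ s t ≤ r) (x : V) :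
    distPt N w M x ∈ P μ := by
  intro s t
  simp only [distPt, Sum.elim_inl, Sum.elim_inr]
  rw [← sub_le_iff_le_add]
  refine le_truncDist ?_ fun r walk => ?_
  · linarith [hM s t, truncDist_nonneg hw hM₀ x (N.terminal t)]
  · rw [sub_le_comm]
    refine le_truncDist ?_ fun r' walk' => ?_
    · linarith [hM s t, walk.nonneg hw]
    · linarith [hle s t _ (walk.trans walk')]

lemma exists_flpFeasible_of_le_pathLength [Finite S] [Nonempty S] (hμ : IsDirectedDistance μ)
    (hw : ∀ e, 0 ≤ w e) (hle : ∀ p : SPath N, μ p.source p.target ≤ pathLength w p.nodes) :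
    ∃ ρ, FLPFeasible (posPart (P μ)) N ρ ∧ signedCost N ρ ≤ ∑ e, (N.cap e : ℝ) * w e := by
  obtain ⟨M, hM⟩ := (Set.finite_range fun a : S × S => μ a.1 a.2).bddAbove
  have hM (s t : S) : μ s t ≤ M := hM ⟨(s, t), rfl⟩
  obtain ⟨s₀⟩ := ‹Nonempty S›
  have hM₀ : 0 ≤ M := (hμ.1 s₀ s₀).trans (hM s₀ s₀)
  refine ⟨distPt N w M, flpFeasible_iff.2 ⟨fun x => ⟨distPt_mem_P hw hM hM₀
    (fun s t r walk => walk.le_of_le_pathLength hμ hw hle) x, ?_⟩, fun s => ?_⟩, ?_⟩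
  · rintro (s | s)
    exacts [truncDist_nonneg hw hM₀ _ _, truncDist_nonneg hw hM₀ _ _]
  · simp [zeroSet, distPt, truncDist_self hw hM₀]
  · refine Finset.sum_le_sum fun e _ => mul_le_mul_of_nonneg_left ?_ (Nat.cast_nonneg _)
    exact signedDinf_le (fun s => truncDist_sub_truncDist_le_right hw hM₀ _ e)
      fun s => truncDist_sub_truncDist_le_left hw hM₀ _ e

lemma FLPFeasible.le_pathLength [Finite S] (hρ : FLPFeasible (posPart (P μ)) N ρ) (p : SPath N) :
    μ p.source p.target ≤ pathLength (fun e : N.edges => Dinf (ρ e.1.1) (ρ e.1.2)) p.nodes :=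
  calc μ p.source p.target
      ≤ ρ (N.terminal p.target) (Sum.inl p.source) + ρ (N.terminal p.target) (Sum.inr p.target) :=
        (hρ.1 _).1 _ _
    _ = ρ (N.terminal p.target) (Sum.inl p.source) -
          ρ (N.terminal p.source) (Sum.inl p.source) := by
        rw [(hρ.eq_zero p.target).2, (hρ.eq_zero p.source).1, add_zero, sub_zero]
    _ ≤ pathLength (fun e : N.edges => Dinf (ρ e.1.1) (ρ e.1.2)) p.nodes :=
        p.isPath.sub_le_pathLength (g := fun x => ρ x (Sum.inl p.source))
          fun e => sub_inl_le_Dinf _ _ _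

lemma IsMFPOpt.le_FLPCost [Finite S] {v : ℝ} (hv : IsMFPOpt μ N v)
    (hρ : FLPFeasible (posPart (P μ)) N ρ) : v ≤ FLPCost N ρ := by
  obtain ⟨f, rfl⟩ := hv.1
  exact f.val_le (fun e => Dinf_nonneg _ _) hρ.le_pathLength

end Location

/-! ### Representatives in a slimmed section -/

section Representatives

variable {S : Type*} {μ : S → S → ℝ} {R : Set (Pt S)} {p q r r' : Pt S} {h k : ℝ} {X : Set S}
  {s : S}

/-- The point `r` is equivalent to `p` in the slimmed tropical polytope, and `h` is the length of
the displacement from `p` to `r` along `(𝟙, -𝟙)`. A displacement along `(𝟙_{X^c}, -𝟙_{X^r})` between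
degenerate points is encoded by leaving the coordinates in `X` unconstrained; for `X = S` it is a
translation, which keeps `h` unique. -/
def Represents (μ : S → S → ℝ) (p r : Pt S) (h : ℝ) : Prop :=
  r = translate p h ∨ ∃ X ≠ Set.univ, p ∈ Qdeg μ X ∧ r ∈ Qdeg μ X ∧
    ∀ s ∉ X, r (Sum.inl s) = p (Sum.inl s) + h ∧ r (Sum.inr s) = p (Sum.inr s) - h

lemma SlimRel.exists_represents (hrp : SlimRel μ r p) : ∃ h, Represents μ p r h := by
  have of_mem_line (hline : r - p ∈ line S) : ∃ h, Represents μ p r h :=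
    (sub_mem_line_iff.1 hline).imp fun _ => Or.inl
  rcases hrp with hline | ⟨X, -, hr, hp, hspan⟩
  · exact of_mem_line hline
  rcases eq_or_ne X Set.univ with rfl | hX
  · exact of_mem_line (by rwa [line, sup_idem] at hspan)
  · simp only [line, Submodule.mem_sup, Submodule.mem_span_singleton] at hspan
    obtain ⟨_, ⟨a, rfl⟩, _, ⟨b, rfl⟩, sum_eq⟩ := hspan
    refine ⟨a, Or.inr ⟨X, hX, hp, hr, fun s hs => ?_⟩⟩
    have eq_inl : a = r (Sum.inl s) - p (Sum.inl s) := by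
      simpa [vec, hs] using congrFun sum_eq (Sum.inl s)
    have eq_inr : -a = r (Sum.inr s) - p (Sum.inr s) := by
      simpa [vec, hs] using congrFun sum_eq (Sum.inr s)
    constructor <;> linarith

lemma IsSlimSection.exists_represents (hR : IsSlimSection μ R) (hp : p ∈ Qslim μ) :
    ∃ r ∈ R, ∃ h, Represents μ p r h := by
  obtain ⟨r, hr, hrp⟩ := hR.2.surjOn
    (Set.mem_univ (Quotient.mk (slimSetoid μ) ⟨p, hp⟩ : SlimmedTropicalPolytope μ))
  exact ⟨r.1, hr, SlimRel.exists_represents (Quotient.exact hrp)⟩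

namespace Represents

variable (hμ : ∀ s, μ s s = 0) (hpr : Represents μ p r h)

include hμ hpr

lemma zeroSet_eq : zeroSet r = zeroSet p := by
  rcases hpr with rfl | ⟨X, -, hp, hr, -⟩
  · exact zeroSet_translate p h
  · rw [← eq_zeroSet_of_mem_Qdeg hμ hp, ← eq_zeroSet_of_mem_Qdeg hμ hr]

lemma mem_Qdeg (hr : r ∈ Q μ) (hp : p ∈ Qdeg μ X) : r ∈ Qdeg μ X := by
  rcases hpr with rfl | ⟨Y, -, hpY, hrY, -⟩
  · exact Qdeg_of_sub_mem_line μ hr (sub_mem_line_iff.2 ⟨h, rfl⟩) hp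
  · rwa [eq_zeroSet_of_mem_Qdeg hμ hp, ← eq_zeroSet_of_mem_Qdeg hμ hpY]

lemma coord (hr : r ∈ Qdeg μ X) (hs : s ∉ X) :
    r (Sum.inl s) = p (Sum.inl s) + h ∧ r (Sum.inr s) = p (Sum.inr s) - h := by
  rcases hpr with rfl | ⟨Y, -, -, hrY, hY⟩
  · simp
  · refine hY s ?_
    rwa [eq_zeroSet_of_mem_Qdeg hμ hrY, ← eq_zeroSet_of_mem_Qdeg hμ hr]

end Represents

lemma IsNonnegSlimmedSection.signedDinf_le_of_mem_Qdeg (hμ : IsDirectedDistance μ)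
    (hR : IsNonnegSlimmedSection μ R) (hp : p ∈ R) (hq : q ∈ R) (hX : X ≠ Set.univ)
    (hpX : p ∈ Qdeg μ X) (hqX : q ∈ Qdeg μ X) {d : ℝ}
    (hinl : ∀ s ∉ X, q (Sum.inl s) - p (Sum.inl s) ≤ d)
    (hinr : ∀ s ∉ X, p (Sum.inr s) - q (Sum.inr s) ≤ d) : signedDinf p q ≤ d := by
  obtain ⟨s₀, hs₀⟩ := (Set.ne_univ_iff_exists_notMem X).1 hX
  have : Nonempty S := ⟨s₀⟩
  have exists_le : ∃ s ∉ X, p (Sum.inl s) ≤ q (Sum.inl s) := by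
    rcases eq_or_ne q p with rfl | hne
    · exact ⟨s₀, hs₀, le_rfl⟩
    · have slimmed := hR.2.2.2 X ?_ q ⟨hq, hqX, (hR.1 hq).2⟩ p ⟨hp, hpX, (hR.1 hp).2⟩ hne
      · simpa only [not_forall, not_lt, exists_prop] using (not_or.1 slimmed).1
      · rw [eq_zeroSet_of_mem_Qdeg hμ.2 hpX]
        exact zeroSet_mem_zeroSets hμ.1 hpX.1.1.1
  have d_nonneg : 0 ≤ d := by
    obtain ⟨s, hs, hle⟩ := exists_le
    exact (sub_nonneg.2 hle).trans (hinl s hs)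
  have eq_zero {r : Pt S} (hr : r ∈ R) (hrX : r ∈ Qdeg μ X) {s : S} (hs : s ∈ X) :
      r (Sum.inl s) = 0 ∧ r (Sum.inr s) = 0 :=
    eq_zero_of_mem_zeroSet (hR.1 hr).2 (eq_zeroSet_of_mem_Qdeg hμ.2 hrX ▸ hs)
  refine signedDinf_le (fun s => ?_) (fun s => ?_) <;> by_cases hs : s ∈ X
  · simpa [eq_zero hp hpX hs, eq_zero hq hqX hs] using d_nonneg
  · exact hinl s hs
  · simpa [eq_zero hp hpX hs, eq_zero hq hqX hs] using d_nonneg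
  · exact hinr s hs

variable [Finite S] [Nonempty S]

lemma Represents.signedDinf_left_le (hμ : IsDirectedDistance μ) (hpr : Represents μ p r h)
    (hq : q ∈ Qslim μ) (hdeg : ∀ X ≠ Set.univ, r ∈ Qdeg μ X → q ∉ Qdeg μ X) :
    signedDinf r q ≤ signedDinf p q - h := by
  rcases hpr with rfl | ⟨X, hX, -, hr, coord⟩
  · linarith [translate_zero q ▸ signedDinf_translate p q h 0]
  · obtain rfl := eq_zeroSet_of_mem_Qdeg hμ.2 hr
    refine signedDinf_le_of_inr hr.1.1.1 hq.1
      (sub_inr_le_of_notMem_Qdeg hμ hr.1.1.1 hq (hdeg _ hX hr) fun s hs => ?_)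
    linarith [(coord s hs).2, sub_inr_le_signedDinf p q s]

lemma Represents.signedDinf_right_le (hμ : IsDirectedDistance μ) (hpr : Represents μ p r h)
    (hq : q ∈ Qslim μ) (hdeg : ∀ X ≠ Set.univ, r ∈ Qdeg μ X → q ∉ Qdeg μ X) :
    signedDinf q r ≤ signedDinf q p + h := by
  rcases hpr with rfl | ⟨X, hX, -, hr, coord⟩
  · simpa using (signedDinf_translate q p 0 h).le
  · obtain rfl := eq_zeroSet_of_mem_Qdeg hμ.2 hr
    refine signedDinf_le_of_inl hq.1 hr.1.1.1
      (sub_inl_le_of_notMem_Qdeg hμ hr.1.1.1 hq (hdeg _ hX hr) fun s hs => ?_)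
    linarith [(coord s hs).1, sub_inl_le_signedDinf q p s]

lemma Represents.signedDinf_le (hμ : IsDirectedDistance μ) (hR : IsNonnegSlimmedSection μ R)
    (hp : p ∈ Qslim μ) (hpr : Represents μ p r h) (hqr : Represents μ q r' k) (hr : r ∈ R)
    (hr' : r' ∈ R) : signedDinf r r' ≤ signedDinf p q + (k - h) := by
  have hrs := (hR.1 hr).1
  have hrs' := (hR.1 hr').1
  by_cases common : ∃ X ≠ Set.univ, r ∈ Qdeg μ X ∧ r' ∈ Qdeg μ X
  · obtain ⟨X, hX, hrX, hrX'⟩ := common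
    refine hR.signedDinf_le_of_mem_Qdeg hμ hr hr' hX hrX hrX' (fun s hs => ?_) fun s hs => ?_
    · linarith [(hpr.coord hμ.2 hrX hs).1, (hqr.coord hμ.2 hrX' hs).1,
        sub_inl_le_signedDinf p q s]
    · linarith [(hpr.coord hμ.2 hrX hs).2, (hqr.coord hμ.2 hrX' hs).2,
        sub_inr_le_signedDinf p q s]
  · have left_le : signedDinf r r' ≤ signedDinf p r' - h :=
      hpr.signedDinf_left_le hμ hrs' fun X hX hrX hrX' => common ⟨X, hX, hrX, hrX'⟩
    have right_le : signedDinf p r' ≤ signedDinf p q + k :=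
      hqr.signedDinf_right_le hμ hp fun X hX hrX' hpX =>
        common ⟨X, hX, hpr.mem_Qdeg hμ.2 hrs.1 hpX, hrX'⟩
    linarith

end Representatives

/-! ### Optimal values -/

section Duality

variable {S V : Type*} {μ : S → S → ℝ} {N : Network S V} {R R' : Set (Pt S)} {ρ : V → Pt S}

lemma IsFLPOpt.of_forall_le {v : ℝ} (hρ : FLPFeasible R N ρ) (hle : FLPCost N ρ ≤ v)
    (hge : ∀ ρ', FLPFeasible R N ρ' → v ≤ FLPCost N ρ') : IsFLPOpt R N v :=
  ⟨⟨ρ, hρ, (hge ρ hρ).antisymm hle⟩, by rintro _ ⟨ρ', hρ', rfl⟩; exact hge ρ' hρ'⟩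

variable [Finite S] [Nonempty S] [Finite V]

lemma exists_flpFeasible_of_isNonnegSlimmedSection (hμ : IsDirectedDistance μ)
    (hN : N.ProperlyInnerEulerian μ) (hR : IsNonnegSlimmedSection μ R)
    (hρ : FLPFeasible (posPart (Qslim μ)) N ρ) :
    ∃ ρ', FLPFeasible R N ρ' ∧ FLPCost N ρ' ≤ signedCost N ρ := by
  choose ρ' mem_R h represents using fun x => hR.2.1.exists_represents (hρ.1 x).1
  have feasible : FLPFeasible R N ρ' := flpFeasible_iff.2
    ⟨mem_R, fun s => (represents (N.terminal s)).zeroSet_eq hμ.2 ▸ (hρ.2 s).2⟩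
  have proper_zero (s : S) (proper : IsProperTerminal μ s) : h (N.terminal s) = 0 := by
    rcases represents (N.terminal s) with eq_translate | ⟨X, -, hX, -⟩
    · have inl_eq := congrFun eq_translate (Sum.inl s)
      rwa [translate_inl, ((feasible.mono hR.1).eq_zero s).1, (hρ.eq_zero s).1, zero_add,
        eq_comm] at inl_eq
    · have fat : IsFat μ (ρ (N.terminal s)) := (isFat_iff hμ).2
        ⟨hX.1.1, ((mem_Qdeg_iff hμ.2).1 hX).2.2.imp And.left And.left⟩
      exact absurd fat (proper _ ⟨hX.1.1, (hρ.2 s).2⟩)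
  refine ⟨ρ', feasible, ?_⟩
  rw [feasible.FLPCost_eq_signedCost hR.2.2.1]
  exact signedCost_le_of_signedDinf_le_add (hN.eq_zero_or_eulerianAt proper_zero) fun x y =>
    (represents x).signedDinf_le hμ hR (hρ.1 x).1 (represents y) (mem_R x) (mem_R y)

theorem exists_opt_of_properlyInnerEulerian (hμ : IsDirectedDistance μ)
    (hN : N.ProperlyInnerEulerian μ) (hR : IsNonnegSlimmedSection μ R) :
    ∃ v : ℝ, IsMFPOpt μ N v ∧ IsFLPOpt R N v := by
  have := Fintype.ofFinite V
  have R_subset : R ⊆ posPart (P μ) := fun p hp => ⟨(hR.1 hp).1.1.1, (hR.1 hp).2⟩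
  obtain ⟨v, hv, w, hw, hle, sum_le⟩ := exists_isMFPOpt μ N
  obtain ⟨ρ₁, feasible₁, cost₁⟩ := exists_flpFeasible_of_le_pathLength hμ hw hle
  obtain ⟨ρ₂, feasible₂, cost₂⟩ := exists_flpFeasible_Qslim hμ hN feasible₁
  obtain ⟨ρ₃, feasible₃, cost₃⟩ := exists_flpFeasible_of_isNonnegSlimmedSection hμ hN hR feasible₂
  exact ⟨v, hv, .of_forall_le feasible₃ (cost₃.trans (cost₂.trans (cost₁.trans sum_le)))
    fun ρ hρ => hv.le_FLPCost (hρ.mono R_subset)⟩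

lemma exists_flpFeasible_of_image_mkQ_subset (hN : N.TotallyEulerian) (hR : IsBalanced R)
    (hR' : IsBalanced R') (hsub : (line S).mkQ '' R ⊆ (line S).mkQ '' R')
    (hρ : FLPFeasible R N ρ) : ∃ ρ', FLPFeasible R' N ρ' ∧ FLPCost N ρ' = FLPCost N ρ := by
  have exists_translate (x : V) : ∃ h, translate (ρ x) h ∈ R' := by
    obtain ⟨q, hq, mkQ_eq⟩ := hsub ⟨_, hρ.1 x, rfl⟩
    obtain ⟨h, rfl⟩ := sub_mem_line_iff.1 ((Submodule.Quotient.eq _).1 mkQ_eq)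
    exact ⟨h, hq⟩
  choose h mem_R' using exists_translate
  have feasible : FLPFeasible R' N fun x => translate (ρ x) (h x) :=
    flpFeasible_iff.2 ⟨mem_R', fun s => by simpa using (flpFeasible_iff.1 hρ).2 s⟩
  refine ⟨_, feasible, ?_⟩
  rw [hρ.FLPCost_eq_signedCost hR, feasible.FLPCost_eq_signedCost hR',
    signedCost_translate fun x => Or.inr (hN x)]

theorem exists_opt_of_totallyEulerian (hμ : IsDirectedDistance μ) (hN : N.TotallyEulerian)
    (hR : IsSlimmedSection μ R) : ∃ v : ℝ, IsMFPOpt μ N v ∧ IsFLPOpt R N v := by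
  obtain ⟨-, balanced, R', hR', image_eq⟩ := hR
  obtain ⟨v, hv, ⟨ρ', hρ', rfl⟩, minimal⟩ :=
    exists_opt_of_properlyInnerEulerian hμ (fun x _ => hN x) hR'
  obtain ⟨ρ, hρ, cost_eq⟩ :=
    exists_flpFeasible_of_image_mkQ_subset hN hR'.2.2.1 balanced image_eq.ge hρ'
  refine ⟨_, hv, .of_forall_le hρ cost_eq.le fun ρ₁ hρ₁ => ?_⟩
  obtain ⟨ρ₂, hρ₂, cost_eq₂⟩ :=
    exists_flpFeasible_of_image_mkQ_subset hN balanced hR'.2.2.1 image_eq.le hρ₁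
  exact (minimal ⟨ρ₂, hρ₂, rfl⟩).trans_eq cost_eq₂

end Duality

section IsEmpty

variable {S V : Type*} [IsEmpty S]

lemma Qslim_nonempty_of_isEmpty (μ : S → S → ℝ) : (Qslim μ).Nonempty := by
  have mem_Q : (0 : Pt S) ∈ Q μ := ⟨isEmptyElim, fun _ _ _ => isEmptyElim⟩
  exact ⟨0, mem_Q, fun fat => fat.2 ∅ (by simp [zeroSets])
    ⟨⟨mem_Q, isEmptyElim⟩, Or.inl (Subsingleton.elim _ _)⟩⟩

lemma exists_opt_of_isEmpty (μ : S → S → ℝ) (N : Network S V) {R : Set (Pt S)}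
    (hR : IsSlimSection μ R) : ∃ v : ℝ, IsMFPOpt μ N v ∧ IsFLPOpt R N v := by
  have val_eq (f : Multiflow N) : f.val μ = 0 :=
    Finset.sum_eq_zero fun p _ => isEmptyElim p.source
  have cost_eq (ρ : V → Pt S) : FLPCost N ρ = 0 := by simp [FLPCost, Dinf, DinfPlus]
  obtain ⟨p, hp⟩ := Qslim_nonempty_of_isEmpty μ
  obtain ⟨r, hr, -⟩ := hR.exists_represents hp
  exact ⟨0, ⟨⟨⟨∅, 0, by simp⟩, val_eq _⟩, by rintro _ ⟨f, rfl⟩; exact (val_eq f).le⟩,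
    .of_forall_le ⟨fun _ => hr, isEmptyElim⟩ (cost_eq _).le fun ρ _ => (cost_eq ρ).ge⟩

end IsEmpty

end DirectedMultiflow

end

open DirectedMultiflow in
theorem mainTheorem2 {S V : Type*} [Finite S] [Finite V] (μ : S → S → ℝ)
    (hμ : IsDirectedDistance μ) (N : Network S V) :
    (∀ R : Set (Pt S), IsNonnegSlimmedSection μ R → N.ProperlyInnerEulerian μ →
      ∃ v : ℝ, IsMFPOpt μ N v ∧ IsFLPOpt R N v) ∧
    (∀ R : Set (Pt S), IsSlimmedSection μ R → N.TotallyEulerian →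
      ∃ v : ℝ, IsMFPOpt μ N v ∧ IsFLPOpt R N v) := by
  rcases isEmpty_or_nonempty S with hS | hS
  · exact ⟨fun R hR _ => exists_opt_of_isEmpty μ N hR.2.1,
      fun R hR _ => exists_opt_of_isEmpty μ N hR.1⟩
  · exact ⟨fun R hR hN => exists_opt_of_properlyInnerEulerian hμ hN hR,
      fun R hR hN => exists_opt_of_totallyEulerian hμ hN hR⟩
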